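/- Let $T:[0,1]\to[0,1]$ be the doubling map, $Tx=2x$ for $x\in[0,1/2]$ and $Tx=2x-1$ for $x\in(1/2,1]$. For $0<a<b<1$ put $\mathcal J(a,b)=\{x\in[0,1]: T^nx\notin(a,b)\text{ for all } n\ge 0\}$, and let $$D_0=\{(a,b)\in(1/4,1/2)\times(1/2,3/4): \mathcal J(a,b)\ne\{0,1\}\},\qquad \phi(a)=\sup\{b\in(a,1):\mathcal J(a,b)\neq\{0,1\}\}.$$ A finite 0-1 word $w$ is \emph{balanced} if any two factors of $w$ of equal length have numbers of 1s that differ by at most one, and \emph{cyclically balanced} if $ww$ is balanced. For a rational $r=p/q\in(0,1)$ in lowest terms let $\omega_r^-$ be the lexicographically largest cyclically balanced word of length $q$ with exactly $p$ ones that begins with 0, and $\omega_r^+$ the lexicographically smallest such word that begins with 1. Identify an infinite 0-1 word $w_1w_2\dots$ with the number $\sum_{n\ge1}w_n2^{-n}$, write $u^\infty=uuu\cdots$, and put $$\Delta(r)=[(\omega_r^-)^\infty,\ \omega_r^-(\omega_r^+)^\infty],\qquad \mathcal S=(1/4,1/2)\setminus\bigcup_{r\in\mathbb Q\cap(0,1)}\Delta(r).$$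 Theorem. The words $\omega_r^\pm$ exist for every $r\in\mathbb Q\cap(0,1)$, and $$D_0=\{(a,b)\in(1/4,1/2)\times(1/2,3/4): b\le\phi(a)\}.$$ For every $r\in\mathbb Q\cap(0,1)$ and every $a\in\Delta(r)$ one has $\phi(a)=(\omega_r^+)^\infty$. Thus $\phi$ is piecewise constant on $(1/4,1/2)$ with an infinite countable set of plateaus and exceptional set $\mathcal S$: the plateaus of $\phi$ in $(1/4,1/2)$ (the maximal nondegenerate intervals contained in $(1/4,1/2)$ on which $\phi$ is constant) are exactly the intervals $\Delta(r)$, $r\in\mathbb Q\cap(0,1)$, which are pairwise disjoint and contained in $(1/4,1/2)$; there are infinitely but countably many of them; the set of points of $(1/4,1/2)$ that lie in no plateau is $\mathcal S$; and $\dim_H\mathcal S=0$. -/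

import Mathlib

noncomputable section

namespace HoleDoubling

/-- The doubling map: `x ↦ 2x` on `[0,1/2]` and `x ↦ 2x - 1` on `(1/2,1]`. -/
def T (x : ℝ) : ℝ := if x ≤ 1 / 2 then 2 * x else 2 * x - 1

/-- The points of `[0,1]` whose orbit under the doubling map avoids the hole `(a,b)`. -/
def J (a b : ℝ) : Set ℝ :=
  {x | x ∈ Set.Icc (0 : ℝ) 1 ∧ ∀ n : ℕ, T^[n] x ∉ Set.Ioo a b}

/-- The rectangle `(1/4,1/2) × (1/2,3/4)`. -/
def box : Set (ℝ × ℝ) := Set.Ioo (1 / 4 : ℝ) (1 / 2) ×ˢ Set.Ioo (1 / 2 : ℝ) (3 / 4)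

/-- The holes in the rectangle that are avoided by some orbit other than the two fixed points. -/
def D0 : Set (ℝ × ℝ) := {p | p ∈ box ∧ J p.1 p.2 ≠ {0, 1}}

/-- `φ(a) = sup {b : J(a,b) ≠ {0,1}}`; holes are nonempty intervals `(a,b)` with `a < b < 1`. -/
def phi (a : ℝ) : ℝ := sSup {b | a < b ∧ b < 1 ∧ J a b ≠ {0, 1}}

/-- A finite 0-1 word is balanced if any two factors of equal length have numbers of ones that
differ by at most one. -/
def Balanced (w : List (Fin 2)) : Prop :=
  ∀ u v : List (Fin 2), u <:+: w → v <:+: w → u.length = v.length →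
    |(u.count 1 : ℤ) - (v.count 1 : ℤ)| ≤ 1

/-- A finite word `w` is cyclically balanced if `ww` is balanced. -/
def CyclicallyBalanced (w : List (Fin 2)) : Prop := Balanced (w ++ w)

/-- For `r = p/q` in lowest terms: the cyclically balanced words of length `q` with 1-ratio `r`
and first letter `c`. -/
def cycWords (r : ℚ) (c : Fin 2) : Set (List (Fin 2)) :=
  {w | CyclicallyBalanced w ∧ w.length = r.den ∧ (w.count 1 : ℚ) / (w.length : ℚ) = r ∧
    w.head? = some c}

/-- `ω_r^-`: the lexicographically largest word of `cycWords r 0`. -/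
def omegaMinus (r : ℚ) : List (Fin 2) := Classical.epsilon (IsGreatest (cycWords r 0))

/-- `ω_r^+`: the lexicographically smallest word of `cycWords r 1`. -/
def omegaPlus (r : ℚ) : List (Fin 2) := Classical.epsilon (IsLeast (cycWords r 1))

/-- The infinite word `u^∞ = uuu⋯` (for a nonempty word `u`). -/
def perpetual (u : List (Fin 2)) : ℕ → Fin 2 := fun n => u.getD (n % u.length) 0

/-- The infinite word `uw`, for a finite word `u` and an infinite word `w`. -/
def prepend (u : List (Fin 2)) (w : ℕ → Fin 2) : ℕ → Fin 2 :=
  fun n => if n < u.length then u.getD n 0 else w (n - u.length)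

/-- The number `∑_{n ≥ 1} w_n 2^{-n}` with dyadic expansion `w` (the letter `w_n` is `w (n-1)`). -/
def dyadic (w : ℕ → Fin 2) : ℝ := ∑' n : ℕ, ((w n : ℕ) : ℝ) / 2 ^ (n + 1)

/-- `Δ(r) = [(ω_r^-)^∞, ω_r^-(ω_r^+)^∞]`. -/
def Delta (r : ℚ) : Set ℝ :=
  Set.Icc (dyadic (perpetual (omegaMinus r)))
    (dyadic (prepend (omegaMinus r) (perpetual (omegaPlus r))))

/-- `𝒮`: the points of `(1/4,1/2)` that lie in no interval `Δ(r)`, `r ∈ ℚ ∩ (0,1)`. -/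
def exceptionalSet : Set ℝ :=
  Set.Ioo (1 / 4 : ℝ) (1 / 2) \ ⋃ r ∈ Set.Ioo (0 : ℚ) 1, Delta r

/-- `I` is a nondegenerate interval contained in `U` on which `f` is constant. -/
def IsConstancyInterval (f : ℝ → ℝ) (U I : Set ℝ) : Prop :=
  I ⊆ U ∧ I.OrdConnected ∧ I.Nontrivial ∧ ∃ c : ℝ, ∀ x ∈ I, f x = c

/-- The plateaus of `f` in `U`: the maximal nondegenerate intervals in `U` on which `f` is
constant. -/
def plateaus (f : ℝ → ℝ) (U : Set ℝ) : Set (Set ℝ) :=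
  {I | Maximal (IsConstancyInterval f U) I}

end HoleDoubling

end

/-!
Every slope `γ ∈ (0,1)` has a lower word, beginning with `01`, and an upper word, beginning with
`10`, whose prefixes of length `n + 1` contain `⌈nγ⌉` and `⌊nγ⌋ + 1` ones. For rational `γ = r`
they are `(ω_r^-)^∞` and `(ω_r^+)^∞` (`perpetual_omegaMinus`, `perpetual_omegaPlus`): in a
cyclically balanced word every window of length `k` contains `kr` ones, rounded down or up, and
after the prescribed first letter the extremal words attain one of these bounds in all windows that
begin at the second letter (`isLeast_cycWords`, `isGreatest_cycWords`). Exchanging the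
first two letters of the upper word gives the limit word, with value smaller by `1/4`; for rational
slope it is `ω_r^- (ω_r^+)^∞`.

Summation by parts (`dyadic_eq_tsum_ones`) shows that the value of a word is monotone in the counts
of ones in its prefixes. Hence the value of the lower word increases strictly with `γ`; it is
continuous from the left, its limit from the right is the value of the limit word, and it jumps
exactly at the rationals. So the intervals between the lower and the limit word of slope `γ` are
pairwise disjoint and fill `(1/4,1/2)` (`exists_slope`). They are the `Δ(r)` for rational slopes
and single points for irrational ones.

If `a` lies in the interval of slope `γ`, then `J(a,b) ≠ {0,1}` exactly when `b` is at most the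
upper word (`J_ne_iff`). On the one hand the orbit of the upper word avoids the hole
(`dyadic_upperWord_mem_J`). On the other hand, let `b` be larger and let `w` be the itinerary of a
point of `J(a,b)` other than `0` and `1`. Let `D(n)` be the number of ones among the first `n`
letters of `w`, minus `nγ`. Comparing the shifts of `w` that begin with `0` with the limit word
shows that `D(m) ≤ D(n) + 1` for all `m ≥ n` when the letter at `n` is `0`. Comparing those that
begin with `1` with the upper word leads from each letter `1` to a later letter `1` at which `D` is
larger by a fixed positive amount, because `b` exceeds the upper word by a fixed amount. These two
facts contradict each other.

Hence `φ` equals the upper word of slope `γ` on the interval of slope `γ`, and its level sets are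
these intervals, which gives the plateaus. The exceptional set consists of values of lower words.
The prefix of length `n` of a lower word depends monotonically on the slope, so it takes at most
`n ^ 2 + 1` values; this polynomial number of sets of diameter `2 ^ (-n)` covers the exceptional
set for every `n`, so its dimension is zero (`dimH_lowerWord_image`).
-/

namespace HoleDoubling

/-! ### Binary expansions and counts of ones -/

/-- The number of ones among the first `n` letters of `w`. -/
def ones (w : ℕ → Fin 2) (n : ℕ) : ℤ := ∑ j ∈ Finset.range n, ((w j : ℕ) : ℤ)

/-- The infinite word that remains of `w` after its first `n` letters are deleted. -/
def shift (n : ℕ) (w : ℕ → Fin 2) : ℕ → Fin 2 := fun j => w (n + j)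

@[simp] lemma ones_zero (w : ℕ → Fin 2) : ones w 0 = 0 := rfl

lemma ones_succ (w : ℕ → Fin 2) (n : ℕ) : ones w (n + 1) = ones w n + ((w n : ℕ) : ℤ) :=
  Finset.sum_range_succ _ _

lemma ones_shift (w : ℕ → Fin 2) (n m : ℕ) :
    ones (shift n w) m = ones w (n + m) - ones w n := by
  simp [ones, shift, Finset.sum_range_add]

lemma ones_congr {u v : ℕ → Fin 2} {k : ℕ} (h : ∀ j < k, u j = v j) {m : ℕ} (hm : m ≤ k) :
    ones u m = ones v m :=
  Finset.sum_congr rfl fun j hj => by rw [h j ((Finset.mem_range.1 hj).trans_le hm)]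

lemma letter_eq_zero_or_one (c : Fin 2) : c = 0 ∨ c = 1 := by
  fin_cases c <;> simp

lemma letter_le_one (c : Fin 2) : ((c : ℕ) : ℝ) ≤ 1 := by
  rcases letter_eq_zero_or_one c with rfl | rfl <;> simp

lemma ones_nonneg (w : ℕ → Fin 2) (n : ℕ) : 0 ≤ ones w n :=
  Finset.sum_nonneg fun _ _ => by positivity

lemma ones_le (w : ℕ → Fin 2) (n : ℕ) : ones w n ≤ n := by
  induction n with
  | zero => simp
  | succ n ih =>
    rw [ones_succ]
    rcases letter_eq_zero_or_one (w n) with h | h <;> simp [h] <;> linarith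

lemma summable_half_pow_succ : Summable fun n : ℕ => (1 : ℝ) / 2 ^ (n + 1) := by
  have := (summable_geometric_two).mul_right (1 / 2 : ℝ)
  refine this.congr fun n => ?_
  rw [div_pow, one_pow, pow_succ]; field_simp

lemma tsum_half_pow_succ : ∑' n : ℕ, (1 : ℝ) / 2 ^ (n + 1) = 1 := by
  have h := tsum_geometric_two
  rw [summable_geometric_two.tsum_eq_zero_add] at h
  have : ∀ n : ℕ, (1 : ℝ) / 2 ^ (n + 1) = (1 / 2) ^ (n + 1) := fun n => by rw [div_pow, one_pow]
  simp only [this]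
  norm_num at h ⊢
  linarith

lemma summable_dyadic (w : ℕ → Fin 2) :
    Summable fun n : ℕ => ((w n : ℕ) : ℝ) / 2 ^ (n + 1) :=
  summable_half_pow_succ.of_nonneg_of_le (fun _ => by positivity) fun n => by
    gcongr; exact letter_le_one _

lemma summable_nat_div_pow : Summable fun n : ℕ => (n : ℝ) / 2 ^ (n + 1) := by
  have := (summable_pow_mul_geometric_of_norm_lt_one 1 (r := (1 / 2 : ℝ))
    (by norm_num)).mul_right (1 / 2)
  refine this.congr fun n => ?_
  rw [div_pow, one_pow, pow_one, pow_succ]; field_simp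

lemma summable_ones (w : ℕ → Fin 2) :
    Summable fun n : ℕ => (ones w n : ℝ) / 2 ^ (n + 1) :=
  summable_nat_div_pow.of_nonneg_of_le
    (fun n => div_nonneg (by exact_mod_cast ones_nonneg w n) (by positivity)) fun n => by
      gcongr; exact_mod_cast ones_le w n

/-- Summation by parts: a number is read off from the counts of ones in the prefixes of its
expansion. Hence a word whose prefixes all contain at least as many ones has at least as large
a value. -/
lemma dyadic_eq_tsum_ones (w : ℕ → Fin 2) :
    dyadic w = ∑' n : ℕ, (ones w n : ℝ) / 2 ^ (n + 1) := by
  have h1 := (summable_ones w).tsum_eq_zero_add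
  have h2 : ∀ n : ℕ, (ones w (n + 1) : ℝ) / 2 ^ (n + 1 + 1) =
      (1 / 2) * ((ones w n : ℝ) / 2 ^ (n + 1)) + (1 / 2) * (((w n : ℕ) : ℝ) / 2 ^ (n + 1)) := by
    intro n
    rw [ones_succ, pow_succ _ (n + 1)]
    push_cast
    field_simp
  simp only [h2] at h1
  rw [((summable_ones w).mul_left _).tsum_add ((summable_dyadic w).mul_left _), tsum_mul_left,
    tsum_mul_left] at h1
  simp only [ones_zero, Int.cast_zero, zero_div, zero_add] at h1
  change dyadic w = _
  have : dyadic w = ∑' n : ℕ, ((w n : ℕ) : ℝ) / 2 ^ (n + 1) := rfl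
  rw [← this] at h1
  linarith

lemma dyadic_le_of_ones_le {u v : ℕ → Fin 2} (h : ∀ n, ones u n ≤ ones v n) :
    dyadic u ≤ dyadic v := by
  rw [dyadic_eq_tsum_ones, dyadic_eq_tsum_ones]
  refine (summable_ones u).tsum_le_tsum (fun n => ?_) (summable_ones v)
  gcongr
  exact_mod_cast h n

lemma dyadic_lt_of_ones_le {u v : ℕ → Fin 2} (h : ∀ n, ones u n ≤ ones v n) {m : ℕ}
    (hm : ones u m < ones v m) : dyadic u < dyadic v := by
  rw [dyadic_eq_tsum_ones, dyadic_eq_tsum_ones]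
  refine (summable_ones u).tsum_lt_tsum (i := m) (fun n => ?_) ?_ (summable_ones v)
  · change _ / _ ≤ _ / _
    gcongr
    exact_mod_cast h n
  · gcongr

lemma dyadic_nonneg (w : ℕ → Fin 2) : 0 ≤ dyadic w :=
  tsum_nonneg fun _ => by positivity

lemma dyadic_le_one (w : ℕ → Fin 2) : dyadic w ≤ 1 := by
  rw [← tsum_half_pow_succ]
  refine (summable_dyadic w).tsum_le_tsum (fun n => ?_) summable_half_pow_succ
  gcongr
  exact letter_le_one _

lemma dyadic_pos {w : ℕ → Fin 2} {n : ℕ} (h : 0 < ones w n) : 0 < dyadic w := by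
  have := dyadic_lt_of_ones_le (u := fun _ => 0) (v := w) (m := n)
    (fun k => by simpa [ones] using ones_nonneg w k) (by simpa [ones] using h)
  exact (dyadic_nonneg _).trans_lt this

lemma dyadic_eq_head_add (w : ℕ → Fin 2) :
    dyadic w = ((w 0 : ℕ) : ℝ) / 2 + dyadic (shift 1 w) / 2 := by
  rw [dyadic, (summable_dyadic w).tsum_eq_zero_add, dyadic, ← tsum_div_const]
  congr 1
  · simp
  · refine tsum_congr fun n => ?_
    rw [shift, add_comm 1 n, pow_succ _ (n + 1)]
    field_simp

lemma shift_shift (m n : ℕ) (w : ℕ → Fin 2) : shift m (shift n w) = shift (n + m) w := by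
  funext j; simp [shift, add_assoc]

@[simp] lemma shift_zero (w : ℕ → Fin 2) : shift 0 w = w := by funext j; simp [shift]

lemma dyadic_eq_prefix_add (w : ℕ → Fin 2) (k : ℕ) :
    dyadic w = ∑ j ∈ Finset.range k, ((w j : ℕ) : ℝ) / 2 ^ (j + 1) + dyadic (shift k w) / 2 ^ k := by
  induction k with
  | zero => simp
  | succ k ih =>
    rw [ih, dyadic_eq_head_add (shift k w), shift_shift, Finset.sum_range_succ, pow_succ]
    simp only [shift, add_zero]
    field_simp
    ring

/-- Words with a common prefix of length `k` have values within `2 ^ (-k)` of each other. -/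
lemma dyadic_le_add_of_prefix_eq {u v : ℕ → Fin 2} {k : ℕ} (h : ∀ j < k, u j = v j) :
    dyadic u ≤ dyadic v + 1 / 2 ^ k := by
  rw [dyadic_eq_prefix_add u k, dyadic_eq_prefix_add v k]
  have : ∑ j ∈ Finset.range k, ((u j : ℕ) : ℝ) / 2 ^ (j + 1) =
      ∑ j ∈ Finset.range k, ((v j : ℕ) : ℝ) / 2 ^ (j + 1) :=
    Finset.sum_congr rfl fun j hj => by rw [h j (Finset.mem_range.1 hj)]
  rw [this]
  have h1 : dyadic (shift k u) / 2 ^ k ≤ 1 / 2 ^ k := by gcongr; exact dyadic_le_one _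
  have h2 : 0 ≤ dyadic (shift k v) / 2 ^ k := div_nonneg (dyadic_nonneg _) (by positivity)
  linarith

lemma dyadic_sub_of_prefix_eq {u v : ℕ → Fin 2} {k : ℕ} (h : ∀ j < k, u j = v j)
    (hu : u k = 1) (hv : v k = 0) :
    dyadic u - dyadic v =
      (1 + dyadic (shift (k + 1) u) - dyadic (shift (k + 1) v)) / 2 ^ (k + 1) := by
  rw [dyadic_eq_prefix_add u (k + 1), dyadic_eq_prefix_add v (k + 1), Finset.sum_range_succ,
    Finset.sum_range_succ]
  have : ∑ j ∈ Finset.range k, ((u j : ℕ) : ℝ) / 2 ^ (j + 1) =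
      ∑ j ∈ Finset.range k, ((v j : ℕ) : ℝ) / 2 ^ (j + 1) :=
    Finset.sum_congr rfl fun j hj => by rw [h j (Finset.mem_range.1 hj)]
  rw [this, hu, hv]
  simp
  ring

lemma exists_first_difference {u v : ℕ → Fin 2} (h : u ≠ v) :
    ∃ k, (∀ j < k, u j = v j) ∧ (u k = 0 ∧ v k = 1 ∨ u k = 1 ∧ v k = 0) := by
  classical
  have h' : ∃ k, u k ≠ v k := Function.ne_iff.1 h
  refine ⟨Nat.find h', fun j hj => by simpa using Nat.find_min h' hj, ?_⟩
  have := Nat.find_spec h'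
  rcases letter_eq_zero_or_one (u (Nat.find h')) with h1 | h1 <;>
  rcases letter_eq_zero_or_one (v (Nat.find h')) with h2 | h2 <;> simp_all

/-- A gap between two values forces their expansions to differ at an early place. -/
lemma exists_first_difference_of_dyadic_lt {u v : ℕ → Fin 2} {K : ℕ}
    (h : dyadic v + 1 / 2 ^ K < dyadic u) :
    ∃ k < K, (∀ j < k, u j = v j) ∧ u k = 1 ∧ v k = 0 := by
  have hK : (0 : ℝ) < 1 / 2 ^ K := by positivity
  have hne : u ≠ v := by rintro rfl; linarith
  obtain ⟨k, hk, h1⟩ := exists_first_difference hne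
  rcases h1 with ⟨h1, h2⟩ | ⟨h1, h2⟩
  · exfalso
    have := dyadic_sub_of_prefix_eq (fun j hj => (hk j hj).symm) h2 h1
    have h3 : 0 ≤ dyadic v - dyadic u := by
      rw [this]
      have := dyadic_le_one (shift (k + 1) u)
      have := dyadic_nonneg (shift (k + 1) v)
      exact div_nonneg (by linarith) (by positivity)
    linarith
  · refine ⟨k, ?_, hk, h1, h2⟩
    by_contra hkK
    have := dyadic_le_add_of_prefix_eq (k := K) fun j hj => hk j (by omega)
    linarith

/-- The order of values agrees with the lexicographic order, apart from the two expansions of a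
dyadic rational; the positivity assumption excludes the expansion that ends in zeros. -/
lemma exists_first_difference_of_dyadic_le {u v : ℕ → Fin 2} (h : dyadic u ≤ dyadic v)
    (hpos : ∀ k, 0 < dyadic (shift k u)) (hne : u ≠ v) :
    ∃ k, (∀ j < k, u j = v j) ∧ u k = 0 ∧ v k = 1 := by
  obtain ⟨k, hk, h1⟩ := exists_first_difference hne
  rcases h1 with h1 | ⟨h1, h2⟩
  · exact ⟨k, hk, h1⟩
  · exfalso
    have h4 := dyadic_sub_of_prefix_eq hk h1 h2
    have h3 : 0 < dyadic u - dyadic v := by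
      rw [h4]
      have := hpos (k + 1)
      have := dyadic_le_one (shift (k + 1) v)
      exact div_pos (by linarith) (by positivity)
    linarith

/-! ### The doubling map and the shift -/

lemma T_dyadic {w : ℕ → Fin 2} (h : 0 < dyadic (shift 1 w)) : T (dyadic w) = dyadic (shift 1 w) := by
  have h1 := dyadic_eq_head_add w
  have h2 := dyadic_le_one (shift 1 w)
  rcases letter_eq_zero_or_one (w 0) with h0 | h0 <;> simp [h0] at h1 <;> unfold T
  · rw [if_pos (by linarith)]; linarith
  · rw [if_neg (by linarith)]; linarith

lemma iterate_T_dyadic {w : ℕ → Fin 2} (h : ∀ n, 0 < dyadic (shift n w)) (n : ℕ) :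
    T^[n] (dyadic w) = dyadic (shift n w) := by
  induction n with
  | zero => simp
  | succ n ih =>
    rw [Function.iterate_succ_apply', ih, T_dyadic (by rw [shift_shift]; exact h _), shift_shift]

lemma T_mem_Icc {x : ℝ} (hx : x ∈ Set.Icc (0 : ℝ) 1) : T x ∈ Set.Icc (0 : ℝ) 1 := by
  obtain ⟨h0, h1⟩ := hx
  unfold T
  split_ifs with h <;> constructor <;> linarith

lemma iterate_T_mem_Icc {x : ℝ} (hx : x ∈ Set.Icc (0 : ℝ) 1) (n : ℕ) :
    T^[n] x ∈ Set.Icc (0 : ℝ) 1 := by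
  induction n with
  | zero => simpa
  | succ n ih => rw [Function.iterate_succ_apply']; exact T_mem_Icc ih

/-- The itinerary of `x` with respect to `[0,1/2]` and `(1/2,1]`. -/
noncomputable def itinerary (x : ℝ) : ℕ → Fin 2 := fun n => if T^[n] x ≤ 1 / 2 then 0 else 1

lemma itinerary_iterate (x : ℝ) (n : ℕ) : itinerary (T^[n] x) = shift n (itinerary x) := by
  funext j
  simp [itinerary, shift, ← Function.iterate_add_apply, add_comm]

lemma dyadic_itinerary {x : ℝ} (hx : x ∈ Set.Icc (0 : ℝ) 1) : dyadic (itinerary x) = x := by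
  -- The error is halved by each step back along the orbit.
  have key : ∀ n : ℕ, |x - dyadic (itinerary x)| =
      |T^[n] x - dyadic (shift n (itinerary x))| / 2 ^ n := by
    intro n
    induction n with
    | zero => simp
    | succ n ih =>
      rw [ih, dyadic_eq_head_add (shift n (itinerary x)), shift_shift,
        Function.iterate_succ_apply', pow_succ]
      have : T^[n] x - (((shift n (itinerary x) 0 : Fin 2) : ℕ) / 2 +
          dyadic (shift (n + 1) (itinerary x)) / 2) =
          (T (T^[n] x) - dyadic (shift (n + 1) (itinerary x))) / 2 := by
        by_cases h : T^[n] x ≤ 1 / 2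
        · simp only [shift, itinerary, T, add_zero, if_pos h]; simp; ring
        · simp only [shift, itinerary, T, add_zero, if_neg h]; simp; ring
      rw [this, abs_div, abs_two]
      field_simp
  have hb : ∀ n : ℕ, |x - dyadic (itinerary x)| ≤ (1 / 2) ^ n := by
    intro n
    rw [key n, div_pow, one_pow]
    gcongr
    have h1 := iterate_T_mem_Icc hx n
    have h2 := dyadic_nonneg (shift n (itinerary x))
    have h3 := dyadic_le_one (shift n (itinerary x))
    rw [abs_le]; constructor <;> linarith [h1.1, h1.2]
  have h0 : |x - dyadic (itinerary x)| ≤ 0 :=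
    ge_of_tendsto' (tendsto_pow_atTop_nhds_zero_of_lt_one (by norm_num) (by norm_num)) hb
  have := abs_nonpos_iff.1 h0
  linarith

/-! ### Words of slope `γ` -/

/-- The word in which the first `n` letters contain `F n` ones, provided that `F 0 = 0` and that
`F` increases by `0` or `1` at each step. -/
def ofCount (F : ℕ → ℤ) : ℕ → Fin 2 := fun n => if F (n + 1) = F n then 0 else 1

lemma ones_ofCount {F : ℕ → ℤ} (h0 : F 0 = 0) (h : ∀ n, F (n + 1) = F n ∨ F (n + 1) = F n + 1)
    (n : ℕ) : ones (ofCount F) n = F n := by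
  induction n with
  | zero => simp [h0]
  | succ n ih =>
    rw [ones_succ, ih]
    rcases h n with h | h <;> simp [ofCount, h]

/-- For rational slope `r` this is `(ω_r^-)^∞`; its prefix of length `n + 1` contains `⌈nγ⌉` ones.
At `n = 0` truncated subtraction gives the correct count `0`. -/
noncomputable def lowerWord (γ : ℝ) : ℕ → Fin 2 := ofCount fun n => ⌈((n - 1 : ℕ) : ℝ) * γ⌉

/-- For rational slope `r` this is `(ω_r^+)^∞`; its prefix of length `n + 1` contains `⌊nγ⌋ + 1`
ones. -/
noncomputable def upperWord (γ : ℝ) : ℕ → Fin 2 :=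
  ofCount fun n => if n = 0 then 0 else ⌊((n - 1 : ℕ) : ℝ) * γ⌋ + 1

/-- For rational slope `r` this is `ω_r^- (ω_r^+)^∞`. It arises from `upperWord γ` by exchanging
the first two letters `10` for `01`, and is the limit of `lowerWord` at `γ` from the right. -/
noncomputable def limitWord (γ : ℝ) : ℕ → Fin 2 :=
  ofCount fun n => if n ≤ 1 then 0 else ⌊((n - 1 : ℕ) : ℝ) * γ⌋ + 1

lemma floor_add_eq_or {x γ : ℝ} (hγ : γ ∈ Set.Icc (0 : ℝ) 1) :
    ⌊x + γ⌋ = ⌊x⌋ ∨ ⌊x + γ⌋ = ⌊x⌋ + 1 := by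
  have h1 : ⌊x⌋ ≤ ⌊x + γ⌋ := Int.floor_mono (by linarith [hγ.1])
  have h2 : ⌊x + γ⌋ ≤ ⌊x + 1⌋ := Int.floor_mono (by linarith [hγ.2])
  rw [Int.floor_add_one] at h2
  omega

lemma ceil_add_eq_or {x γ : ℝ} (hγ : γ ∈ Set.Icc (0 : ℝ) 1) :
    ⌈x + γ⌉ = ⌈x⌉ ∨ ⌈x + γ⌉ = ⌈x⌉ + 1 := by
  have h1 : ⌈x⌉ ≤ ⌈x + γ⌉ := Int.ceil_mono (by linarith [hγ.1])
  have h2 : ⌈x + γ⌉ ≤ ⌈x + 1⌉ := Int.ceil_mono (by linarith [hγ.2])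
  rw [Int.ceil_add_one] at h2
  omega

lemma ones_lowerWord {γ : ℝ} (hγ : γ ∈ Set.Icc (0 : ℝ) 1) (n : ℕ) :
    ones (lowerWord γ) n = ⌈((n - 1 : ℕ) : ℝ) * γ⌉ := by
  refine ones_ofCount (by simp) (fun n => ?_) n
  rcases n with _ | n
  · simp
  · have := ceil_add_eq_or (x := n * γ) hγ
    simp only [Nat.add_sub_cancel]
    push_cast
    rwa [add_one_mul]

lemma ones_upperWord {γ : ℝ} (hγ : γ ∈ Set.Icc (0 : ℝ) 1) (n : ℕ) :
    ones (upperWord γ) n = if n = 0 then 0 else ⌊((n - 1 : ℕ) : ℝ) * γ⌋ + 1 := by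
  refine ones_ofCount (by simp) (fun n => ?_) n
  rcases n with _ | n
  · simp
  · have := floor_add_eq_or (x := n * γ) hγ
    simp only [Nat.add_sub_cancel]
    push_cast
    rw [add_one_mul]
    simp
    omega

lemma ones_limitWord {γ : ℝ} (hγ : γ ∈ Set.Ico (0 : ℝ) 1) (n : ℕ) :
    ones (limitWord γ) n = if n ≤ 1 then 0 else ⌊((n - 1 : ℕ) : ℝ) * γ⌋ + 1 := by
  refine ones_ofCount (by simp) (fun n => ?_) n
  rcases n with _ | _ | n
  · simp
  · have : ⌊γ⌋ = 0 := Int.floor_eq_zero_iff.2 hγ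
    simp [this]
  · have := floor_add_eq_or (x := (n + 1) * γ) (Set.Ico_subset_Icc_self hγ)
    simp only [Nat.add_sub_cancel]
    push_cast
    rw [add_one_mul ((n : ℝ) + 1)]
    simp
    omega

lemma upperWord_zero {γ : ℝ} : upperWord γ 0 = 1 := by simp [upperWord, ofCount]

lemma lowerWord_zero {γ : ℝ} : lowerWord γ 0 = 0 := by simp [lowerWord, ofCount]

lemma limitWord_zero {γ : ℝ} : limitWord γ 0 = 0 := by simp [limitWord, ofCount]

/-- A later multiple of `γ < γ'` separates the two slopes by any prescribed amount. -/
lemma exists_nat_mul_add_le {γ γ' : ℝ} (h : γ < γ') (C : ℝ) :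
    ∃ n : ℕ, (n + 1 : ℝ) * γ + C ≤ (n + 1 : ℝ) * γ' := by
  obtain ⟨n, hn⟩ := exists_nat_ge (C / (γ' - γ))
  have hpos : 0 < γ' - γ := by linarith
  rw [div_le_iff₀ hpos] at hn
  exact ⟨n, by nlinarith⟩

lemma dyadic_lowerWord_le_limitWord {γ : ℝ} (hγ : γ ∈ Set.Ico (0 : ℝ) 1) :
    dyadic (lowerWord γ) ≤ dyadic (limitWord γ) := by
  refine dyadic_le_of_ones_le fun n => ?_
  rw [ones_lowerWord (Set.Ico_subset_Icc_self hγ), ones_limitWord hγ]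
  split_ifs with h
  · have : n - 1 = 0 := by omega
    simp [this]
  · exact Int.ceil_le_floor_add_one _

lemma dyadic_limitWord_lt_lowerWord {γ γ' : ℝ} (hγ : 0 ≤ γ) (hγ' : γ' ≤ 1) (h : γ < γ') :
    dyadic (limitWord γ) < dyadic (lowerWord γ') := by
  have h1 : γ ∈ Set.Ico (0 : ℝ) 1 := ⟨hγ, h.trans_le hγ'⟩
  have h2 : γ' ∈ Set.Icc (0 : ℝ) 1 := ⟨hγ.trans h.le, hγ'⟩
  obtain ⟨m, hm⟩ := exists_nat_mul_add_le h 2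
  refine dyadic_lt_of_ones_le (m := m + 2) (fun n => ?_) ?_
  · rw [ones_lowerWord h2, ones_limitWord h1]
    split_ifs with hn
    · have : n - 1 = 0 := by omega
      simp [this]
    · rw [Int.add_one_le_iff, Int.lt_ceil]
      have : (1 : ℝ) ≤ ((n - 1 : ℕ) : ℝ) := by exact_mod_cast (by omega : 1 ≤ n - 1)
      have := Int.floor_le (((n - 1 : ℕ) : ℝ) * γ)
      nlinarith
  · rw [ones_lowerWord h2, ones_limitWord h1]
    simp only [Nat.add_succ_sub_one, show ¬ (m + 2 ≤ 1) by omega, if_false, Int.lt_ceil]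
    have := Int.floor_le (((m + 1 : ℕ) : ℝ) * γ)
    push_cast at this ⊢
    linarith

lemma dyadic_lowerWord_strictMonoOn :
    StrictMonoOn (fun γ => dyadic (lowerWord γ)) (Set.Icc 0 1) := fun _ hγ _ hγ' h =>
  (dyadic_lowerWord_le_limitWord ⟨hγ.1, h.trans_le hγ'.2⟩).trans_lt
    (dyadic_limitWord_lt_lowerWord hγ.1 hγ'.2 h)

lemma dyadic_upperWord_eq {γ : ℝ} (hγ : γ ∈ Set.Ico (0 : ℝ) 1) :
    dyadic (upperWord γ) = dyadic (limitWord γ) + 1 / 4 := by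
  have h : ∀ n : ℕ, (ones (upperWord γ) n : ℝ) / 2 ^ (n + 1) =
      (ones (limitWord γ) n : ℝ) / 2 ^ (n + 1) + if n = 1 then 1 / 4 else 0 := by
    intro n
    rw [ones_upperWord (Set.Ico_subset_Icc_self hγ), ones_limitWord hγ]
    rcases n with _ | _ | n
    · simp
    · norm_num
    · simp
  rw [dyadic_eq_tsum_ones, dyadic_eq_tsum_ones, ← tsum_ite_eq 1 (fun _ => (1 / 4 : ℝ)),
    ← (summable_ones _).tsum_add (summable_of_hasFiniteSupport
      ((Set.finite_singleton 1).subset fun n hn => by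
        by_contra h; exact hn (if_neg h)))]
  exact tsum_congr h

lemma dyadic_limitWord_zero : dyadic (limitWord 0) = 1 / 4 := by
  have h : ∀ n : ℕ, ((limitWord 0 n : ℕ) : ℝ) / 2 ^ (n + 1) = if n = 1 then 1 / 4 else 0 := by
    intro n
    rcases n with _ | _ | n
    · simp [limitWord, ofCount]
    · norm_num [limitWord, ofCount]
    · simp [limitWord, ofCount]
  rw [dyadic, tsum_congr h, tsum_ite_eq]

lemma dyadic_lowerWord_zero : dyadic (lowerWord 0) = 0 := by
  simp [dyadic, lowerWord, ofCount]

lemma dyadic_lowerWord_one : dyadic (lowerWord 1) = 1 / 2 := by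
  have h : shift 1 (lowerWord 1) = fun _ => 1 := by
    funext n
    simp [shift, lowerWord, ofCount]
  have h1 : dyadic (fun _ => 1) = 1 := by
    rw [← tsum_half_pow_succ]
    simp [dyadic]
  rw [dyadic_eq_head_add, h, lowerWord_zero, h1]
  simp

lemma one_fourth_lt_dyadic_lowerWord {γ : ℝ} (hγ : γ ∈ Set.Ioo (0 : ℝ) 1) :
    1 / 4 < dyadic (lowerWord γ) :=
  dyadic_limitWord_zero ▸ dyadic_limitWord_lt_lowerWord le_rfl hγ.2.le hγ.1

lemma dyadic_limitWord_lt_half {γ : ℝ} (hγ : γ ∈ Set.Ioo (0 : ℝ) 1) :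
    dyadic (limitWord γ) < 1 / 2 :=
  dyadic_lowerWord_one ▸ dyadic_limitWord_lt_lowerWord hγ.1.le le_rfl hγ.2

lemma ceil_eq_floor_add_one_of_irrational {x : ℝ} (hx : Irrational x) : ⌈x⌉ = ⌊x⌋ + 1 := by
  refine le_antisymm (Int.ceil_le_floor_add_one x) ?_
  rw [Int.add_one_le_iff, Int.lt_ceil]
  exact lt_of_le_of_ne (Int.floor_le x) fun h => hx.ne_int _ h.symm

lemma dyadic_lowerWord_eq_of_irrational {γ : ℝ} (hγ : γ ∈ Set.Ico (0 : ℝ) 1) (h : Irrational γ) :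
    dyadic (lowerWord γ) = dyadic (limitWord γ) := by
  refine le_antisymm (dyadic_lowerWord_le_limitWord hγ) (dyadic_le_of_ones_le fun n => ?_)
  rw [ones_lowerWord (Set.Ico_subset_Icc_self hγ), ones_limitWord hγ]
  split_ifs with hn
  · have : n - 1 = 0 := by omega
    simp [this]
  · rw [ceil_eq_floor_add_one_of_irrational]
    exact h.natCast_mul (by omega)

lemma dyadic_lowerWord_lt_of_rational {r : ℚ} (hr : r ∈ Set.Ico (0 : ℚ) 1) :
    dyadic (lowerWord r) < dyadic (limitWord r) := by
  have hγ : (r : ℝ) ∈ Set.Ico (0 : ℝ) 1 := ⟨by exact_mod_cast hr.1, by exact_mod_cast hr.2⟩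
  refine dyadic_lt_of_ones_le (m := r.den + 1) (fun n => ?_) ?_
  · rw [ones_lowerWord (Set.Ico_subset_Icc_self hγ), ones_limitWord hγ]
    split_ifs with hn
    · have : n - 1 = 0 := by omega
      simp [this]
    · exact Int.ceil_le_floor_add_one _
  · rw [ones_lowerWord (Set.Ico_subset_Icc_self hγ), ones_limitWord hγ]
    have h1 : ((r.den : ℕ) : ℝ) * (r : ℝ) = (r.num : ℝ) := by
      exact_mod_cast r.den_mul_eq_num
    have := r.den_pos
    rw [if_neg (by omega), Nat.add_sub_cancel, h1]
    simp

open Filter Topology in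
lemma tendsto_dyadic_of_ones {ι : Type*} {l : Filter ι} [l.IsCountablyGenerated]
    {w : ι → ℕ → Fin 2} {v : ℕ → Fin 2} (h : ∀ n, ∀ᶠ i in l, ones (w i) n = ones v n) :
    Tendsto (fun i => dyadic (w i)) l (𝓝 (dyadic v)) := by
  simp only [dyadic_eq_tsum_ones]
  refine tendsto_tsum_of_dominated_convergence summable_nat_div_pow (fun n => ?_)
    (Eventually.of_forall fun i n => ?_)
  · refine tendsto_const_nhds.congr' ?_
    filter_upwards [h n] with i hi
    rw [hi]
  · have h1 := ones_nonneg (w i) n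
    rw [Real.norm_of_nonneg (div_nonneg (by exact_mod_cast h1) (by positivity))]
    gcongr
    exact_mod_cast ones_le _ _

open Filter Topology in
lemma tendsto_dyadic_lowerWord_left {γ : ℝ} (hγ : γ ∈ Set.Ioc (0 : ℝ) 1) :
    Tendsto (fun x => dyadic (lowerWord x)) (𝓝[<] γ) (𝓝 (dyadic (lowerWord γ))) := by
  refine tendsto_dyadic_of_ones fun n => ?_
  have h1 : Tendsto (fun x : ℝ => ((n - 1 : ℕ) : ℝ) * x) (𝓝[<] γ)
      (𝓝[≤] (((n - 1 : ℕ) : ℝ) * γ)) := by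
    refine tendsto_nhdsWithin_of_tendsto_nhds_of_eventually_within _
      ((Continuous.tendsto (by fun_prop) γ).mono_left nhdsWithin_le_nhds) ?_
    filter_upwards [self_mem_nhdsWithin] with x hx
    exact mul_le_mul_of_nonneg_left (le_of_lt (Set.mem_Iio.1 hx)) (Nat.cast_nonneg _)
  have h2 := tendsto_pure.1 ((tendsto_ceil_left_pure_ceil _).comp h1)
  filter_upwards [h2, Ioo_mem_nhdsLT hγ.1] with x hx hx0
  rw [ones_lowerWord ⟨hx0.1.le, hx0.2.le.trans hγ.2⟩, ones_lowerWord ⟨hγ.1.le, hγ.2⟩]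
  exact hx

open Filter Topology in
lemma tendsto_dyadic_lowerWord_right {γ : ℝ} (hγ : γ ∈ Set.Ico (0 : ℝ) 1) :
    Tendsto (fun x => dyadic (lowerWord x)) (𝓝[>] γ) (𝓝 (dyadic (limitWord γ))) := by
  refine tendsto_dyadic_of_ones fun n => ?_
  by_cases hn : n ≤ 1
  · filter_upwards [Ioo_mem_nhdsGT hγ.2] with x hx
    have : n - 1 = 0 := by omega
    rw [ones_lowerWord ⟨hγ.1.trans hx.1.le, hx.2.le⟩, ones_limitWord hγ, if_pos hn, this]
    simp
  have hpos : (0 : ℝ) < ((n - 1 : ℕ) : ℝ) := by exact_mod_cast (by omega : 0 < n - 1)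
  have h1 : Tendsto (fun x : ℝ => ((n - 1 : ℕ) : ℝ) * x) (𝓝[>] γ)
      (𝓝[>] (((n - 1 : ℕ) : ℝ) * γ)) := by
    refine tendsto_nhdsWithin_of_tendsto_nhds_of_eventually_within _
      ((Continuous.tendsto (by fun_prop) γ).mono_left nhdsWithin_le_nhds) ?_
    filter_upwards [self_mem_nhdsWithin] with x hx
    exact mul_lt_mul_of_pos_left (Set.mem_Ioi.1 hx) hpos
  have h2 := tendsto_pure.1 ((tendsto_ceil_right_pure_floor_add_one _).comp h1)
  filter_upwards [h2, Ioo_mem_nhdsGT hγ.2] with x hx hx0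
  rw [ones_lowerWord ⟨hγ.1.trans hx0.1.le, hx0.2.le⟩, ones_limitWord hγ, if_neg hn]
  exact hx

/-- The intervals `[lowerWord γ, limitWord γ]` fill `(1/4,1/2)`: they are the values and the jumps
of the increasing function `γ ↦ lowerWord γ`. -/
lemma exists_slope {a : ℝ} (ha : a ∈ Set.Ioo (1 / 4 : ℝ) (1 / 2)) :
    ∃ γ ∈ Set.Ioo (0 : ℝ) 1,
      a ∈ Set.Icc (dyadic (lowerWord γ)) (dyadic (limitWord γ)) := by
  set S : Set ℝ := {γ | γ ∈ Set.Icc (0 : ℝ) 1 ∧ dyadic (lowerWord γ) ≤ a} with hS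
  have hne : S.Nonempty := ⟨0, by simp, by rw [dyadic_lowerWord_zero]; linarith [ha.1]⟩
  have hbdd : BddAbove S := ⟨1, fun γ hγ => hγ.1.2⟩
  set γ := sSup S with hγdef
  have h0 : 0 ≤ γ := le_csSup hbdd ⟨by simp, by rw [dyadic_lowerWord_zero]; linarith [ha.1]⟩
  have h1 : γ ≤ 1 := csSup_le hne fun γ hγ => hγ.1.2
  have hlow : dyadic (lowerWord γ) ≤ a := by
    rcases h0.eq_or_lt with h | h
    · rw [← h, dyadic_lowerWord_zero]; linarith [ha.1]
    · refine le_of_tendsto (tendsto_dyadic_lowerWord_left ⟨h, h1⟩) ?_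
      filter_upwards [Ioo_mem_nhdsLT h] with x hx
      obtain ⟨y, hy, hxy⟩ := exists_lt_of_lt_csSup hne hx.2
      exact (dyadic_lowerWord_strictMonoOn ⟨hx.1.le, hx.2.le.trans h1⟩ hy.1 hxy).le.trans hy.2
  have h1' : γ < 1 := by
    refine lt_of_le_of_ne h1 fun h => ?_
    rw [h, dyadic_lowerWord_one] at hlow
    linarith [ha.2]
  have hup : a ≤ dyadic (limitWord γ) := by
    refine ge_of_tendsto (tendsto_dyadic_lowerWord_right ⟨h0, h1'⟩) ?_
    filter_upwards [Ioo_mem_nhdsGT h1'] with x hx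
    by_contra hcon
    exact absurd (le_csSup hbdd (show x ∈ S from ⟨⟨h0.trans hx.1.le, hx.2.le⟩, (not_le.1 hcon).le⟩))
      (not_le.2 hx.1)
  refine ⟨γ, ⟨lt_of_le_of_ne h0 fun h => ?_, h1'⟩, hlow, hup⟩
  rw [← h, dyadic_limitWord_zero] at hup
  linarith [ha.1]

/-! ### Orbits that avoid a hole -/

lemma ones_upperWord_succ {γ : ℝ} (hγ : γ ∈ Set.Icc (0 : ℝ) 1) (n : ℕ) :
    ones (upperWord γ) (n + 1) = ⌊(n : ℝ) * γ⌋ + 1 := by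
  simp [ones_upperWord hγ]

lemma ones_le_succ (w : ℕ → Fin 2) (n : ℕ) : ones w n ≤ ones w (n + 1) := by
  rw [ones_succ]; simp

lemma dyadic_shift_upperWord_pos {γ : ℝ} (hγ : γ ∈ Set.Ioo (0 : ℝ) 1) (n : ℕ) :
    0 < dyadic (shift n (upperWord γ)) := by
  have hγ' := Set.Ioo_subset_Icc_self hγ
  obtain ⟨m, hm⟩ := exists_nat_ge (1 / γ)
  rw [div_le_iff₀ hγ.1] at hm
  refine dyadic_pos (n := m + 1) ?_
  have h1 := ones_le_succ (upperWord γ) n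
  rw [ones_shift, ← add_assoc, ones_upperWord_succ hγ']
  rw [ones_upperWord_succ hγ'] at h1
  have h2 : ⌊(n : ℝ) * γ + 1⌋ ≤ ⌊((n + m : ℕ) : ℝ) * γ⌋ := Int.floor_mono (by push_cast; linarith)
  rw [Int.floor_add_one] at h2
  linarith

/-- The orbit of the upper word avoids the hole between the lower and the upper word: each of its
shifts that begins with `0` is at most the lower word, each one that begins with `1` at least the
upper word. -/
lemma dyadic_upperWord_mem_J {γ a : ℝ} (hγ : γ ∈ Set.Ioo (0 : ℝ) 1)
    (ha : dyadic (lowerWord γ) ≤ a) : dyadic (upperWord γ) ∈ J a (dyadic (upperWord γ)) := by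
  have hγ' := Set.Ioo_subset_Icc_self hγ
  refine ⟨⟨dyadic_nonneg _, dyadic_le_one _⟩, fun n hn => ?_⟩
  rw [iterate_T_dyadic (dyadic_shift_upperWord_pos hγ)] at hn
  have hs := ones_succ (upperWord γ) n
  rcases letter_eq_zero_or_one (upperWord γ n) with h | h
  · refine absurd hn.1 (not_lt.2 (le_trans (dyadic_le_of_ones_le fun m => ?_) ha))
    rw [h, ones_upperWord_succ hγ'] at hs
    rcases m with _ | m
    · simp
    · rw [ones_shift, ← add_assoc, ones_upperWord_succ hγ', ones_lowerWord hγ', Nat.add_sub_cancel]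
      have h1 : ⌊((n + m : ℕ) : ℝ) * γ⌋ < ⌊(n : ℝ) * γ⌋ + 1 + ⌈(m : ℝ) * γ⌉ := by
        rw [Int.floor_lt]
        push_cast
        linarith [Int.lt_floor_add_one ((n : ℝ) * γ), Int.le_ceil ((m : ℝ) * γ)]
      simp at hs
      linarith
  · refine absurd hn.2 (not_lt.2 (dyadic_le_of_ones_le fun m => ?_))
    rw [h, ones_upperWord_succ hγ'] at hs
    rcases m with _ | m
    · simp
    · rw [ones_shift, ← add_assoc, ones_upperWord_succ hγ', ones_upperWord_succ hγ']
      have h1 : ⌊(n : ℝ) * γ⌋ + ⌊(m : ℝ) * γ⌋ ≤ ⌊((n + m : ℕ) : ℝ) * γ⌋ := by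
        rw [Int.le_floor]
        push_cast
        linarith [Int.floor_le ((n : ℝ) * γ), Int.floor_le ((m : ℝ) * γ)]
      simp at hs
      linarith

lemma iterate_T_zero (n : ℕ) : T^[n] 0 = 0 :=
  Function.iterate_fixed (by norm_num [T]) n

lemma iterate_T_one (n : ℕ) : T^[n] 1 = 1 :=
  Function.iterate_fixed (by norm_num [T]) n

lemma fixed_points_subset_J {a b : ℝ} (ha : 0 ≤ a) (hb : b ≤ 1) : {0, 1} ⊆ J a b := by
  rintro x (rfl | rfl)
  · exact ⟨by simp, fun n => by rw [iterate_T_zero]; exact fun h => absurd h.1 (not_lt.2 ha)⟩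
  · exact ⟨by simp, fun n => by rw [iterate_T_one]; exact fun h => absurd h.2 (not_lt.2 hb)⟩

/-- An orbit reaches a fixed point only from that point itself or through `1/2`. -/
lemma iterate_T_ne_of_mem_J {a b x : ℝ} (ha : a < 1 / 2) (hb : 1 / 2 < b) (hx : x ∈ J a b)
    (h0 : x ≠ 0) (h1 : x ≠ 1) (n : ℕ) : T^[n] x ≠ 0 ∧ T^[n] x ≠ 1 := by
  induction n with
  | zero => exact ⟨h0, h1⟩
  | succ n ih =>
    rw [Function.iterate_succ_apply']
    have h2 : T^[n] x ≠ 1 / 2 := fun h => hx.2 n (by rw [h]; exact ⟨ha, hb⟩)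
    unfold T at *
    split_ifs with h
    · exact ⟨fun h' => ih.1 (by linarith), fun h' => h2 (by linarith)⟩
    · exact ⟨fun h' => h2 (by linarith), fun h' => ih.2 (by linarith)⟩

lemma exists_pos_le_floor_add_one_sub (γ : ℝ) (K : ℕ) :
    ∃ δ > 0, ∀ k < K, δ ≤ (⌊(k : ℝ) * γ⌋ : ℝ) + 1 - k * γ := by
  induction K with
  | zero => exact ⟨1, one_pos, by simp⟩
  | succ K ih =>
    obtain ⟨δ, hδ, h⟩ := ih
    refine ⟨min δ ((⌊(K : ℝ) * γ⌋ : ℝ) + 1 - K * γ),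
      lt_min hδ (by linarith [Int.lt_floor_add_one ((K : ℝ) * γ)]), fun k hk => ?_⟩
    rcases Nat.lt_succ_iff_lt_or_eq.1 hk with hk | rfl
    · exact (min_le_left _ _).trans (h k hk)
    · exact min_le_right _ _

/-- If no shift that begins with `0` exceeds the limit word of slope `γ`, then after a letter `0`
the number of ones grows by at most `γ` per letter, up to an error of one. -/
lemma ones_le_of_dyadic_shift_le {γ : ℝ} (hγ : γ ∈ Set.Ioo (0 : ℝ) 1) {w : ℕ → Fin 2}
    (hpos : ∀ n, 0 < dyadic (shift n w))
    (h : ∀ n, w n = 0 → dyadic (shift n w) ≤ dyadic (limitWord γ)) (d : ℕ) :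
    ∀ n, w n = 0 → (ones w (n + d) : ℝ) ≤ ones w n + d * γ + 1 := by
  have hγ' : γ ∈ Set.Ico (0 : ℝ) 1 := ⟨hγ.1.le, hγ.2⟩
  have hle : ∀ d : ℕ, (ones (limitWord γ) d : ℝ) ≤ d * γ + 1 := by
    intro d
    rw [ones_limitWord hγ']
    split_ifs with hd
    · have := mul_nonneg (Nat.cast_nonneg (α := ℝ) d) hγ.1.le
      push_cast
      linarith
    · have h1 := Int.floor_le (((d - 1 : ℕ) : ℝ) * γ)
      have h2 : ((d - 1 : ℕ) : ℝ) ≤ d := by exact_mod_cast Nat.sub_le d 1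
      have h3 := mul_le_mul_of_nonneg_right h2 hγ.1.le
      push_cast
      linarith
  induction d using Nat.strong_induction_on with
  | _ d ih =>
  intro n hn
  have hsplit : ∀ m, (ones w (n + m) : ℝ) = ones w n + ones (shift n w) m := by
    intro m; rw [ones_shift]; push_cast; ring
  by_cases heq : shift n w = limitWord γ
  · rw [hsplit, heq]
    linarith [hle d]
  obtain ⟨k, hk, h0, h1⟩ := exists_first_difference_of_dyadic_le (h n hn)
    (fun k => by rw [shift_shift]; exact hpos _) heq
  have hk0 : k ≠ 0 := by
    rintro rfl
    simp [limitWord_zero] at h1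
  rcases le_or_gt d k with hd | hd
  · rw [hsplit, ones_congr hk hd]
    linarith [hle d]
  · -- At the first difference the count is back below slope `γ`, and the word again reads `0`.
    have h2 := ih (d - k) (by omega) (n + k) h0
    have h3 := ones_succ (limitWord γ) k
    rw [ones_limitWord hγ' (k + 1), if_neg (by omega), Nat.add_sub_cancel, h1] at h3
    have h4 : ones (limitWord γ) k = ⌊(k : ℝ) * γ⌋ := by
      simp at h3; omega
    have h5 := Int.floor_le ((k : ℝ) * γ)
    rw [hsplit k, ones_congr hk le_rfl, h4, Nat.cast_sub hd.le,
      show n + k + (d - k) = n + d by omega] at h2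
    linarith

/-- If all shifts that begin with `1` exceed the upper word of slope `γ` by a fixed amount, then
from each letter `1` a later letter `1` is reached on which the excess of the number of ones over
slope `γ` is larger by a fixed amount. -/
lemma exists_excess_of_lt_dyadic_shift {γ b : ℝ} (hγ : γ ∈ Set.Ioo (0 : ℝ) 1) {w : ℕ → Fin 2}
    (hb : dyadic (upperWord γ) < b) (h : ∀ n, w n = 1 → b ≤ dyadic (shift n w)) :
    ∃ δ > 0, ∀ n, w n = 1 → ∃ k, w (n + k) = 1 ∧
      (ones w n : ℝ) + k * γ + δ ≤ ones w (n + k) := by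
  obtain ⟨K, hK⟩ := exists_pow_lt_of_lt_one (sub_pos.2 hb) (by norm_num : (1 / 2 : ℝ) < 1)
  obtain ⟨δ, hδ, hδK⟩ := exists_pos_le_floor_add_one_sub γ K
  refine ⟨δ, hδ, fun n hn => ?_⟩
  rw [div_pow, one_pow] at hK
  obtain ⟨k, hkK, hk, h1, h0⟩ := exists_first_difference_of_dyadic_lt
    (u := shift n w) (v := upperWord γ) (K := K) (by linarith [h n hn])
  refine ⟨k, h1, ?_⟩
  have h2 := ones_shift w n k
  have h3 := ones_succ (upperWord γ) k
  rw [ones_upperWord_succ (Set.Ioo_subset_Icc_self hγ), h0] at h3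
  rw [ones_congr hk le_rfl] at h2
  have h4 : ones w (n + k) = ones w n + ⌊(k : ℝ) * γ⌋ + 1 := by simp at h3; omega
  rw [h4]
  push_cast
  linarith [hδK k hkK]

lemma exists_letter_eq_zero {w : ℕ → Fin 2} {n : ℕ} (h : dyadic (shift n w) ≠ 1) :
    ∃ m, w (n + m) = 0 := by
  by_contra! hcon
  refine h ?_
  have : shift n w = fun _ => 1 := by
    funext m
    exact (letter_eq_zero_or_one _).resolve_left (hcon m)
  rw [this, ← tsum_half_pow_succ]
  simp [dyadic]

lemma exists_letter_eq_one {w : ℕ → Fin 2} {n : ℕ} (h : dyadic (shift n w) ≠ 0) :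
    ∃ m, w (n + m) = 1 := by
  by_contra! hcon
  refine h ?_
  have : shift n w = fun _ => 0 := by
    funext m
    exact (letter_eq_zero_or_one _).resolve_right (hcon m)
  rw [this]
  simp [dyadic]

lemma J_eq_of_dyadic_upperWord_lt {γ a b : ℝ} (hγ : γ ∈ Set.Ioo (0 : ℝ) 1) (ha0 : 0 ≤ a)
    (ha : a ≤ dyadic (limitWord γ)) (hb : dyadic (upperWord γ) < b) (hb1 : b < 1) :
    J a b = {0, 1} := by
  refine Set.Subset.antisymm (fun x hx => ?_) (fixed_points_subset_J ha0 hb1.le)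
  by_contra hcon
  have h0 : x ≠ 0 := fun h => hcon (by simp [h])
  have h1 : x ≠ 1 := fun h => hcon (by simp [h])
  have hγ' : γ ∈ Set.Ico (0 : ℝ) 1 := ⟨hγ.1.le, hγ.2⟩
  have ha2 : a < 1 / 2 := ha.trans_lt (dyadic_limitWord_lt_half hγ)
  have hb2 : 1 / 2 < b := by
    have := dyadic_upperWord_eq hγ'
    have := dyadic_lowerWord_le_limitWord hγ'
    have := one_fourth_lt_dyadic_lowerWord hγ
    linarith
  set w := itinerary x with hw
  have horb : ∀ n, dyadic (shift n w) = T^[n] x := fun n => by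
    rw [hw, ← itinerary_iterate, dyadic_itinerary (iterate_T_mem_Icc hx.1 n)]
  have hne := iterate_T_ne_of_mem_J ha2 hb2 hx h0 h1
  have hpos : ∀ n, 0 < dyadic (shift n w) := fun n =>
    lt_of_le_of_ne (dyadic_nonneg _) (by rw [horb]; exact (hne n).1.symm)
  have hzero : ∀ n, w n = 0 → dyadic (shift n w) ≤ dyadic (limitWord γ) := by
    intro n hn
    rw [horb]
    have h2 : T^[n] x ≤ 1 / 2 := by
      by_contra h
      simp only [hw, itinerary, if_neg h] at hn
      exact absurd hn (by decide)
    by_contra h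
    exact hx.2 n ⟨by linarith, by linarith⟩
  have hone : ∀ n, w n = 1 → b ≤ dyadic (shift n w) := by
    intro n hn
    rw [horb]
    have h2 : ¬ T^[n] x ≤ 1 / 2 := by
      intro h
      simp only [hw, itinerary, if_pos h] at hn
      exact absurd hn (by decide)
    by_contra h
    exact hx.2 n ⟨by linarith, by linarith⟩
  obtain ⟨n, hn⟩ := exists_letter_eq_zero (w := w) (n := 0) (by rw [horb]; exact (hne 0).2)
  rw [zero_add] at hn
  obtain ⟨m, hm⟩ := exists_letter_eq_one (w := w) (n := n) (by rw [horb]; exact (hne n).1)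
  have hup := ones_le_of_dyadic_shift_le hγ hpos hzero
  obtain ⟨δ, hδ, hchain⟩ := exists_excess_of_lt_dyadic_shift hγ hb hone
  -- The excess of the number of ones over slope `γ` is unbounded along the letters `1` after
  -- position `n`, but bounded after the letter `0` at position `n`.
  have hiter : ∀ j : ℕ, ∃ k, w (n + m + k) = 1 ∧
      (ones w (n + m) : ℝ) + k * γ + j * δ ≤ ones w (n + m + k) := by
    intro j
    induction j with
    | zero => exact ⟨0, hm, by simp⟩
    | succ j ih =>
      obtain ⟨k, hk, hk'⟩ := ih
      obtain ⟨l, hl, hl'⟩ := hchain _ hk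
      refine ⟨k + l, by rw [← add_assoc]; exact hl, ?_⟩
      rw [← add_assoc]
      push_cast
      linarith
  obtain ⟨j, hj⟩ := exists_nat_gt (((ones w n : ℝ) + m * γ + 1 - ones w (n + m)) / δ)
  rw [div_lt_iff₀ hδ] at hj
  obtain ⟨k, -, hk⟩ := hiter j
  have := hup (m + k) n hn
  rw [← add_assoc] at this
  push_cast at this
  linarith

lemma J_antitone {a b b' : ℝ} (h : b ≤ b') : J a b' ⊆ J a b := fun _ hx =>
  ⟨hx.1, fun n hn => hx.2 n ⟨hn.1, hn.2.trans_le h⟩⟩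

lemma dyadic_upperWord_bounds {γ : ℝ} (hγ : γ ∈ Set.Ioo (0 : ℝ) 1) :
    1 / 2 < dyadic (upperWord γ) ∧ dyadic (upperWord γ) < 3 / 4 := by
  have hγ' : γ ∈ Set.Ico (0 : ℝ) 1 := ⟨hγ.1.le, hγ.2⟩
  have := dyadic_upperWord_eq hγ'
  have := dyadic_lowerWord_le_limitWord hγ'
  have := one_fourth_lt_dyadic_lowerWord hγ
  have := dyadic_limitWord_lt_half hγ
  constructor <;> linarith

/-- The holes `(a,b)` avoided by some orbit off the fixed points, for `a` in the interval of
slope `γ`. -/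
lemma J_ne_iff {γ a b : ℝ} (hγ : γ ∈ Set.Ioo (0 : ℝ) 1)
    (ha : a ∈ Set.Icc (dyadic (lowerWord γ)) (dyadic (limitWord γ))) (hb : b < 1) :
    J a b ≠ {0, 1} ↔ b ≤ dyadic (upperWord γ) := by
  have ha0 : 0 ≤ a := (dyadic_nonneg _).trans ha.1
  refine ⟨fun h => ?_, fun h heq => ?_⟩
  · by_contra hcon
    exact h (J_eq_of_dyadic_upperWord_lt hγ ha0 ha.2 (not_le.1 hcon) hb)
  · have := J_antitone h (dyadic_upperWord_mem_J hγ ha.1)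
    obtain ⟨h1, h2⟩ := dyadic_upperWord_bounds hγ
    rw [heq] at this
    rcases this with h | h
    · rw [h] at h1; linarith
    · rw [Set.mem_singleton_iff.1 h] at h2; linarith

lemma phi_eq {γ a : ℝ} (hγ : γ ∈ Set.Ioo (0 : ℝ) 1)
    (ha : a ∈ Set.Icc (dyadic (lowerWord γ)) (dyadic (limitWord γ))) :
    phi a = dyadic (upperWord γ) := by
  refine IsGreatest.csSup_eq ⟨?_, fun b hb => (J_ne_iff hγ ha hb.2.1).1 hb.2.2⟩
  obtain ⟨h1, h2⟩ := dyadic_upperWord_bounds hγ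
  have h3 : dyadic (upperWord γ) < 1 := by linarith
  refine ⟨?_, h3, (J_ne_iff hγ ha h3).2 le_rfl⟩
  linarith [ha.2, dyadic_limitWord_lt_half hγ]

/-! ### Finite balanced words -/

lemma count_map_range (f : ℕ → Fin 2) (n : ℕ) :
    ((((List.range n).map f).count 1 : ℕ) : ℤ) = ones f n := by
  induction n with
  | zero => simp
  | succ n ih =>
    rw [List.range_succ, List.map_append, List.count_append, Nat.cast_add, ih, ones_succ]
    rcases letter_eq_zero_or_one (f n) with h | h <;> simp [h]

lemma count_take_drop_map_range (f : ℕ → Fin 2) {n i k : ℕ} (h : i + k ≤ n) :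
    (((((List.range n).map f).drop i).take k).count 1 : ℤ) = ones f (i + k) - ones f i := by
  have h1 : ∀ m ≤ n, ((List.range n).map f).take m = (List.range m).map f := fun m hm => by
    rw [← List.map_take, List.take_range, min_eq_left hm]
  have h2 := congrArg (fun l => ((List.count 1 l : ℕ) : ℤ))
    (List.take_add (l := (List.range n).map f) (i := i) (j := k))
  simp only [List.count_append, Nat.cast_add] at h2
  rw [h1 _ h, h1 i (by omega), count_map_range, count_map_range] at h2
  linarith

lemma balanced_map_range_iff (f : ℕ → Fin 2) (n : ℕ) :
    Balanced ((List.range n).map f) ↔ ∀ i j k, i + k ≤ n → j + k ≤ n →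
      |(ones f (i + k) - ones f i) - (ones f (j + k) - ones f j)| ≤ 1 := by
  constructor
  · intro h i j k hi hj
    rw [← count_take_drop_map_range f hi, ← count_take_drop_map_range f hj]
    refine h _ _ ((List.take_prefix _ _).isInfix.trans (List.drop_suffix _ _).isInfix)
      ((List.take_prefix _ _).isInfix.trans (List.drop_suffix _ _).isInfix) ?_
    simp
    omega
  · intro h u v hu hv huv
    have key : ∀ u : List (Fin 2), u <:+: (List.range n).map f → ∃ i, i + u.length ≤ n ∧
        ((u.count 1 : ℕ) : ℤ) = ones f (i + u.length) - ones f i := by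
      rintro u ⟨s, t, hst⟩
      have hl := congrArg List.length hst
      simp at hl
      refine ⟨s.length, by omega, ?_⟩
      rw [← count_take_drop_map_range f (n := n) (by omega), ← hst]
      simp
    obtain ⟨i, hi, hi'⟩ := key u hu
    obtain ⟨j, hj, hj'⟩ := key v hv
    rw [hi', hj', ← huv]
    exact h i j _ hi (by omega)

lemma map_range_append_self {f : ℕ → Fin 2} {q : ℕ} (hf : ∀ n, f (q + n) = f n) :
    (List.range q).map f ++ (List.range q).map f = (List.range (q + q)).map f := by
  rw [List.range_add, List.map_append, List.map_map]
  congr 1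
  exact List.map_congr_left fun a _ => (hf a).symm

lemma perpetual_map_range {f : ℕ → Fin 2} {q : ℕ} (hq : 0 < q) (hf : ∀ n, f (q + n) = f n) :
    perpetual ((List.range q).map f) = f := by
  funext n
  have h1 := Nat.mod_lt n hq
  have h2 : ∀ m k, f (q * m + k) = f k := by
    intro m k
    induction m with
    | zero => simp
    | succ m ih => rw [Nat.mul_succ, add_comm _ q, add_assoc, hf, ih]
  rw [perpetual, List.length_map, List.length_range, List.getD_eq_getElem _ _ (by simpa using h1)]
  simp only [List.getElem_map, List.getElem_range]
  conv_rhs => rw [← Nat.div_add_mod n q]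
  exact (h2 _ _).symm

lemma perpetual_length_add (w : List (Fin 2)) (n : ℕ) :
    perpetual w (w.length + n) = perpetual w n := by
  simp [perpetual]

lemma map_range_perpetual (w : List (Fin 2)) :
    (List.range w.length).map (perpetual w) = w := by
  refine List.ext_getElem (by simp) fun i h1 h2 => ?_
  simp [perpetual, Nat.mod_eq_of_lt h2, h2]

lemma ones_period_add {f : ℕ → Fin 2} {q : ℕ} (hf : ∀ n, f (q + n) = f n) (n : ℕ) :
    ones f (q + n) = ones f q + ones f n := by
  have := ones_shift f q n
  have h : shift q f = f := funext hf
  rw [h] at this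
  omega

/-- The windows of length `k` in a cyclic word contain on average the expected number of ones. -/
lemma sum_ones_window {f : ℕ → Fin 2} {q : ℕ} (hf : ∀ n, f (q + n) = f n) (k : ℕ) :
    ∑ i ∈ Finset.range q, (ones f (i + k) - ones f i) = k * ones f q := by
  induction k with
  | zero => simp
  | succ k ih =>
    have h : ∑ i ∈ Finset.range q, (((f (k + i) : Fin 2) : ℕ) : ℤ) = ones f q := by
      have h1 : ones (shift k f) q = ones f q := by
        rw [ones_shift, add_comm k q, ones_period_add hf]; ring
      exact h1
    have h2 : ∀ i, ones f (i + (k + 1)) - ones f i =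
        (ones f (i + k) - ones f i) + (((f (k + i) : Fin 2) : ℕ) : ℤ) := fun i => by
      rw [← add_assoc, ones_succ, add_comm k i]; ring
    rw [Finset.sum_congr rfl fun i _ => h2 i, Finset.sum_add_distrib, ih, h]
    push_cast; ring

/-- In a cyclically balanced word the counts of ones in the windows of length `k` differ by at
most one and average to `k * r`, so they are `k * r` rounded down or up. -/
lemma ones_window_bounds {f : ℕ → Fin 2} {q : ℕ} (hf : ∀ n, f (q + n) = f n)
    (hbal : CyclicallyBalanced ((List.range q).map f)) {r : ℝ} (hr : (ones f q : ℝ) = q * r)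
    {i k : ℕ} (hi : i < q) (hk : k ≤ q) :
    ⌊(k : ℝ) * r⌋ ≤ ones f (i + k) - ones f i ∧ ones f (i + k) - ones f i ≤ ⌈(k : ℝ) * r⌉ := by
  rw [CyclicallyBalanced, map_range_append_self hf, balanced_map_range_iff] at hbal
  have hsum : ((∑ i ∈ Finset.range q, (ones f (i + k) - ones f i) : ℤ) : ℝ) = q * (k * r) := by
    rw [sum_ones_window hf]; push_cast; rw [hr]; ring
  constructor
  · by_contra hcon
    have hlt : ∑ j ∈ Finset.range q, (ones f (j + k) - ones f j) <
        ∑ j ∈ Finset.range q, ⌊(k : ℝ) * r⌋ := by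
      refine Finset.sum_lt_sum (fun j hj => ?_) ⟨i, Finset.mem_range.2 hi, not_le.1 hcon⟩
      have := (abs_le.1 (hbal j i k (by have := Finset.mem_range.1 hj; omega) (by omega))).2
      omega
    rw [Finset.sum_const, Finset.card_range, nsmul_eq_mul] at hlt
    have h1 := (Int.cast_lt (R := ℝ)).2 hlt
    rw [hsum] at h1
    push_cast at h1
    have := mul_le_mul_of_nonneg_left (Int.floor_le ((k : ℝ) * r)) (Nat.cast_nonneg (α := ℝ) q)
    linarith
  · by_contra hcon
    have hlt : ∑ j ∈ Finset.range q, ⌈(k : ℝ) * r⌉ <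
        ∑ j ∈ Finset.range q, (ones f (j + k) - ones f j) := by
      refine Finset.sum_lt_sum (fun j hj => ?_) ⟨i, Finset.mem_range.2 hi, not_le.1 hcon⟩
      have := (abs_le.1 (hbal i j k (by omega) (by have := Finset.mem_range.1 hj; omega))).2
      omega
    rw [Finset.sum_const, Finset.card_range, nsmul_eq_mul] at hlt
    have h1 := (Int.cast_lt (R := ℝ)).2 hlt
    rw [hsum] at h1
    push_cast at h1
    have := mul_le_mul_of_nonneg_left (Int.le_ceil ((k : ℝ) * r)) (Nat.cast_nonneg (α := ℝ) q)
    linarith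

lemma map_range_le_of_ones_le {f g : ℕ → Fin 2} {q : ℕ} (h : ∀ n ≤ q, ones f n ≤ ones g n) :
    (List.range q).map f ≤ (List.range q).map g := by
  rw [← not_lt]
  intro hlt
  rcases List.lt_iff_exists.1 hlt with ⟨-, h1⟩ | ⟨i, h1, h2, h3, h4⟩
  · simp at h1
  · simp only [List.length_map, List.length_range] at h1
    simp only [List.getElem_map, List.getElem_range] at h3 h4
    have h5 := h (i + 1) h1
    have h6 := ones_congr (k := i) h3 le_rfl
    rw [ones_succ, ones_succ, h6] at h5
    have : ((g i : ℕ) : ℤ) < (f i : ℕ) := by exact_mod_cast h4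
    linarith

lemma ones_upperWord_eq {γ : ℝ} (hγ : γ ∈ Set.Ioo (0 : ℝ) 1) (n : ℕ) :
    ones (upperWord γ) n = ⌊((n : ℝ) - 1) * γ⌋ + 1 := by
  rcases n with _ | n
  · have : ⌊-γ⌋ = -1 := by rw [Int.floor_eq_iff]; push_cast; constructor <;> linarith [hγ.1, hγ.2]
    simp [this]
  · simp [ones_upperWord (Set.Ioo_subset_Icc_self hγ)]

lemma ones_lowerWord_eq {γ : ℝ} (hγ : γ ∈ Set.Ioo (0 : ℝ) 1) (n : ℕ) :
    ones (lowerWord γ) n = ⌈((n : ℝ) - 1) * γ⌉ := by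
  rcases n with _ | n
  · have : ⌈-γ⌉ = 0 := by rw [Int.ceil_eq_iff]; push_cast; constructor <;> linarith [hγ.1, hγ.2]
    simp [this]
  · simp [ones_lowerWord (Set.Ioo_subset_Icc_self hγ)]

lemma letter_eq_of_ones {u v : ℕ → Fin 2} {m n : ℕ}
    (h : ones u (m + 1) - ones u m = ones v (n + 1) - ones v n) : u m = v n := by
  rw [ones_succ, ones_succ] at h
  ext
  omega

section Rational

variable {r : ℚ}

lemma cast_mem_Ioo (hr : r ∈ Set.Ioo (0 : ℚ) 1) : (r : ℝ) ∈ Set.Ioo (0 : ℝ) 1 :=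
  ⟨by exact_mod_cast hr.1, by exact_mod_cast hr.2⟩

lemma den_mul_cast (r : ℚ) : (r.den : ℝ) * (r : ℝ) = ((r.num : ℤ) : ℝ) := by
  exact_mod_cast r.den_mul_eq_num

lemma ones_upperWord_den_add (hr : r ∈ Set.Ioo (0 : ℚ) 1) (n : ℕ) :
    ones (upperWord r) (r.den + n) = ones (upperWord r) n + r.num := by
  rw [ones_upperWord_eq (cast_mem_Ioo hr), ones_upperWord_eq (cast_mem_Ioo hr)]
  have : (((r.den + n : ℕ) : ℝ) - 1) * r = ((n : ℝ) - 1) * r + ((r.num : ℤ) : ℝ) := by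
    rw [← den_mul_cast]; push_cast; ring
  rw [this, Int.floor_add_intCast]
  ring

lemma ones_lowerWord_den_add (hr : r ∈ Set.Ioo (0 : ℚ) 1) (n : ℕ) :
    ones (lowerWord r) (r.den + n) = ones (lowerWord r) n + r.num := by
  rw [ones_lowerWord_eq (cast_mem_Ioo hr), ones_lowerWord_eq (cast_mem_Ioo hr)]
  have : (((r.den + n : ℕ) : ℝ) - 1) * r = ((n : ℝ) - 1) * r + ((r.num : ℤ) : ℝ) := by
    rw [← den_mul_cast]; push_cast; ring
  rw [this, Int.ceil_add_intCast]

lemma upperWord_den_add (hr : r ∈ Set.Ioo (0 : ℚ) 1) (n : ℕ) :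
    upperWord r (r.den + n) = upperWord r n :=
  letter_eq_of_ones (by
    rw [add_assoc, ones_upperWord_den_add hr, ones_upperWord_den_add hr]; ring)

lemma lowerWord_den_add (hr : r ∈ Set.Ioo (0 : ℚ) 1) (n : ℕ) :
    lowerWord r (r.den + n) = lowerWord r n :=
  letter_eq_of_ones (by
    rw [add_assoc, ones_lowerWord_den_add hr, ones_lowerWord_den_add hr]; ring)

lemma map_range_mem_cycWords {f : ℕ → Fin 2} (hf : ∀ n, f (r.den + n) = f n)
    (hnum : ones f r.den = r.num) {C : ℕ → ℤ}
    (hC : ∀ i k, C k ≤ ones f (i + k) - ones f i ∧ ones f (i + k) - ones f i ≤ C k + 1) :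
    (List.range r.den).map f ∈ cycWords r (f 0) := by
  refine ⟨?_, by simp, ?_, ?_⟩
  · rw [CyclicallyBalanced, map_range_append_self hf, balanced_map_range_iff]
    intro i j k _ _
    have h1 := hC i k
    have h2 := hC j k
    rw [abs_le]
    constructor <;> linarith
  · have h := count_map_range f r.den
    rw [hnum] at h
    have h' : ((((List.range r.den).map f).count 1 : ℕ) : ℚ) = ((r.num : ℤ) : ℚ) := by
      rw [← h]; rfl
    rw [h', List.length_map, List.length_range, Rat.num_div_den]
  · obtain ⟨m, hm⟩ := Nat.exists_eq_succ_of_ne_zero r.den_ne_zero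
    rw [hm, List.range_succ_eq_map]
    simp

/-- The facts about a competing word `w` that are used to compare it with the extremal one. -/
lemma cycWords_spec {c : Fin 2} {w : List (Fin 2)} (hw : w ∈ cycWords r c) :
    w = (List.range r.den).map (perpetual w) ∧ perpetual w 0 = c ∧
      ∀ i k, i < r.den → k ≤ r.den →
        ⌊(k : ℝ) * r⌋ ≤ ones (perpetual w) (i + k) - ones (perpetual w) i ∧
        ones (perpetual w) (i + k) - ones (perpetual w) i ≤ ⌈(k : ℝ) * r⌉ := by
  obtain ⟨hbal, hlen, hratio, hhead⟩ := hw
  have h1 : (List.range r.den).map (perpetual w) = w := by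
    rw [← hlen, map_range_perpetual]
  have hper : ∀ n, perpetual w (r.den + n) = perpetual w n := fun n => by
    rw [← hlen, perpetual_length_add]
  refine ⟨h1.symm, ?_, fun i k hi hk => ones_window_bounds hper (by rwa [h1]) ?_ hi hk⟩
  · rcases w with _ | ⟨d, w⟩
    · simp at hhead
    · simpa [perpetual] using hhead
  · rw [← count_map_range, h1]
    have h2 : ((w.count 1 : ℕ) : ℚ) = r.den * r := by
      have h3 : (w.length : ℚ) ≠ 0 := by rw [hlen]; exact_mod_cast r.den_ne_zero
      rw [div_eq_iff h3, hlen] at hratio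
      rw [hratio, mul_comm]
    exact_mod_cast h2

lemma isLeast_cycWords (hr : r ∈ Set.Ioo (0 : ℚ) 1) :
    IsLeast (cycWords r 1) ((List.range r.den).map (upperWord r)) := by
  have hγ := cast_mem_Ioo hr
  constructor
  · have := map_range_mem_cycWords (r := r) (f := upperWord r) (upperWord_den_add hr)
      (by simpa using ones_upperWord_den_add hr 0) (C := fun k => ⌊(k : ℝ) * r⌋) fun i k => by
        rw [ones_upperWord_eq hγ, ones_upperWord_eq hγ]
        have h1 := Int.le_floor_add (((i : ℝ) - 1) * r) ((k : ℝ) * r)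
        have h2 := Int.le_floor_add_floor (((i : ℝ) - 1) * r) ((k : ℝ) * r)
        have h3 : (((i + k : ℕ) : ℝ) - 1) * r = ((i : ℝ) - 1) * r + k * r := by push_cast; ring
        rw [h3]
        constructor <;> linarith
    rwa [upperWord_zero] at this
  · intro w hw
    obtain ⟨h1, h0, h2⟩ := cycWords_spec hw
    rw [h1]
    refine map_range_le_of_ones_le fun n hn => ?_
    rcases n with _ | _ | n
    · simp
    · simp [ones_succ, h0, upperWord_zero]
    · have h3 := (h2 1 (n + 1) (by omega) (by omega)).1
      have h4 : ones (perpetual w) 1 = 1 := by simp [ones, h0]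
      rw [ones_upperWord_succ (Set.Ioo_subset_Icc_self hγ)]
      rw [h4, add_comm 1] at h3
      linarith

lemma isGreatest_cycWords (hr : r ∈ Set.Ioo (0 : ℚ) 1) :
    IsGreatest (cycWords r 0) ((List.range r.den).map (lowerWord r)) := by
  have hγ := cast_mem_Ioo hr
  constructor
  · have := map_range_mem_cycWords (r := r) (f := lowerWord r) (lowerWord_den_add hr)
      (by simpa using ones_lowerWord_den_add hr 0)
      (C := fun k => ⌈(k : ℝ) * r⌉ - 1) fun i k => by
        rw [ones_lowerWord_eq hγ, ones_lowerWord_eq hγ]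
        have h1 := Int.ceil_add_le (((i : ℝ) - 1) * r) ((k : ℝ) * r)
        have h2 := Int.ceil_add_ceil_le (((i : ℝ) - 1) * r) ((k : ℝ) * r)
        have h3 : (((i + k : ℕ) : ℝ) - 1) * r = ((i : ℝ) - 1) * r + k * r := by push_cast; ring
        rw [h3]
        constructor <;> linarith
    rwa [lowerWord_zero] at this
  · intro w hw
    obtain ⟨h1, h0, h2⟩ := cycWords_spec hw
    rw [h1]
    refine map_range_le_of_ones_le fun n hn => ?_
    rcases n with _ | _ | n
    · simp
    · simp [ones_succ, h0, lowerWord_zero]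
    · have h3 := (h2 1 (n + 1) (by omega) (by omega)).2
      have h4 : ones (perpetual w) 1 = 0 := by simp [ones, h0]
      rw [ones_lowerWord (Set.Ioo_subset_Icc_self hγ), Nat.add_sub_cancel]
      rw [h4, add_comm 1] at h3
      linarith

lemma omegaPlus_spec (hr : r ∈ Set.Ioo (0 : ℚ) 1) : IsLeast (cycWords r 1) (omegaPlus r) :=
  Classical.epsilon_spec ⟨_, isLeast_cycWords hr⟩

lemma omegaMinus_spec (hr : r ∈ Set.Ioo (0 : ℚ) 1) : IsGreatest (cycWords r 0) (omegaMinus r) :=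
  Classical.epsilon_spec ⟨_, isGreatest_cycWords hr⟩

lemma perpetual_omegaPlus (hr : r ∈ Set.Ioo (0 : ℚ) 1) :
    perpetual (omegaPlus r) = upperWord r := by
  rw [(omegaPlus_spec hr).unique (isLeast_cycWords hr),
    perpetual_map_range r.den_pos (upperWord_den_add hr)]

lemma perpetual_omegaMinus (hr : r ∈ Set.Ioo (0 : ℚ) 1) :
    perpetual (omegaMinus r) = lowerWord r := by
  rw [(omegaMinus_spec hr).unique (isGreatest_cycWords hr),
    perpetual_map_range r.den_pos (lowerWord_den_add hr)]

lemma ceil_mul_eq_floor_add_one {k : ℕ} (h0 : 0 < k) (hk : k < r.den) :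
    ⌈(k : ℝ) * r⌉ = ⌊(k : ℝ) * r⌋ + 1 := by
  refine le_antisymm (Int.ceil_le_floor_add_one _) ?_
  rw [Int.add_one_le_iff, Int.lt_ceil]
  refine lt_of_le_of_ne (Int.floor_le _) fun h => ?_
  set z := ⌊(k : ℝ) * r⌋
  have h1 : (z * r.den : ℤ) = k * r.num := by
    have : (z : ℝ) * r.den = k * ((r.num : ℤ) : ℝ) := by rw [h, ← den_mul_cast]; ring
    exact_mod_cast this
  have h2 : (r.den : ℤ) ∣ k * r.num := ⟨z, by rw [← h1, mul_comm]⟩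
  have h3 : IsCoprime (r.den : ℤ) r.num := by
    rw [Int.isCoprime_iff_gcd_eq_one, Int.gcd_comm]
    simpa [Int.gcd] using r.reduced
  have h4 := Int.le_of_dvd (by exact_mod_cast h0) (h3.dvd_of_dvd_mul_right h2)
  omega

lemma one_lt_den (hr : r ∈ Set.Ioo (0 : ℚ) 1) : 1 < r.den := by
  have := r.den_pos
  by_contra hcon
  have h2 : (r.num : ℚ) = r := Rat.coe_int_num_of_den_eq_one (by omega)
  have h3 : (0 : ℚ) < r.num := by rw [h2]; exact hr.1
  have h4 : (r.num : ℚ) < 1 := by rw [h2]; exact hr.2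
  have h5 : 0 < r.num := by exact_mod_cast h3
  have h6 : r.num < 1 := by exact_mod_cast h4
  omega

lemma prepend_omegaMinus (hr : r ∈ Set.Ioo (0 : ℚ) 1) :
    prepend (omegaMinus r) (perpetual (omegaPlus r)) = limitWord r := by
  have hγ := cast_mem_Ioo hr
  have hγ' : (r : ℝ) ∈ Set.Ico (0 : ℝ) 1 := ⟨hγ.1.le, hγ.2⟩
  have hden := one_lt_den hr
  rw [perpetual_omegaPlus hr, (omegaMinus_spec hr).unique (isGreatest_cycWords hr)]
  funext n
  simp only [prepend, List.length_map, List.length_range]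
  split_ifs with hn
  · rw [List.getD_eq_getElem _ _ (by simpa using hn)]
    simp only [List.getElem_map, List.getElem_range]
    have h : ∀ m ≤ r.den, ones (lowerWord r) m = ones (limitWord r) m := by
      intro m hm
      rw [ones_lowerWord (Set.Ioo_subset_Icc_self hγ), ones_limitWord hγ']
      split_ifs with hm1
      · have : m - 1 = 0 := by omega
        simp [this]
      · exact ceil_mul_eq_floor_add_one (by omega) (by omega)
    exact letter_eq_of_ones (by rw [h _ (by omega), h _ (by omega)])
  · have h : upperWord r (n - r.den) = upperWord r n := by
      rw [← upperWord_den_add hr]; congr 1; omega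
    rw [h]
    refine letter_eq_of_ones ?_
    rw [ones_upperWord (Set.Ioo_subset_Icc_self hγ), ones_upperWord (Set.Ioo_subset_Icc_self hγ),
      ones_limitWord hγ', ones_limitWord hγ', if_neg (by omega), if_neg (by omega),
      if_neg (by omega), if_neg (by omega)]

lemma Delta_eq (hr : r ∈ Set.Ioo (0 : ℚ) 1) :
    Delta r = Set.Icc (dyadic (lowerWord r)) (dyadic (limitWord r)) := by
  rw [Delta, prepend_omegaMinus hr, perpetual_omegaMinus hr]

end Rational

/-! ### The plateaus of `φ` -/

lemma dyadic_upperWord_strictMonoOn :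
    StrictMonoOn (fun γ => dyadic (upperWord γ)) (Set.Ioo 0 1) := fun γ hγ γ' hγ' h => by
  have h1 := dyadic_limitWord_lt_lowerWord hγ.1.le hγ'.2.le h
  have h2 := dyadic_lowerWord_le_limitWord ⟨hγ'.1.le, hγ'.2⟩
  change dyadic (upperWord γ) < dyadic (upperWord γ')
  rw [dyadic_upperWord_eq ⟨hγ.1.le, hγ.2⟩, dyadic_upperWord_eq ⟨hγ'.1.le, hγ'.2⟩]
  linarith

lemma slope_unique {γ γ' a : ℝ} (hγ : γ ∈ Set.Ioo (0 : ℝ) 1) (hγ' : γ' ∈ Set.Ioo (0 : ℝ) 1)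
    (h : a ∈ Set.Icc (dyadic (lowerWord γ)) (dyadic (limitWord γ)))
    (h' : a ∈ Set.Icc (dyadic (lowerWord γ')) (dyadic (limitWord γ'))) : γ = γ' :=
  dyadic_upperWord_strictMonoOn.injOn hγ hγ' ((phi_eq hγ h).symm.trans (phi_eq hγ' h'))

lemma Delta_subset {r : ℚ} (hr : r ∈ Set.Ioo (0 : ℚ) 1) :
    Delta r ⊆ Set.Ioo (1 / 4 : ℝ) (1 / 2) := by
  rw [Delta_eq hr]
  exact Set.Icc_subset_Ioo (one_fourth_lt_dyadic_lowerWord (cast_mem_Ioo hr))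
    (dyadic_limitWord_lt_half (cast_mem_Ioo hr))

lemma phi_eq_of_mem_Delta {r : ℚ} (hr : r ∈ Set.Ioo (0 : ℚ) 1) {a : ℝ} (ha : a ∈ Delta r) :
    phi a = dyadic (perpetual (omegaPlus r)) := by
  rw [perpetual_omegaPlus hr]
  exact phi_eq (cast_mem_Ioo hr) (Delta_eq hr ▸ ha)

lemma lowerWord_mem_Delta {r : ℚ} (hr : r ∈ Set.Ioo (0 : ℚ) 1) :
    dyadic (lowerWord r) ∈ Delta r := by
  rw [Delta_eq hr]
  exact ⟨le_rfl, (dyadic_lowerWord_lt_of_rational ⟨hr.1.le, hr.2⟩).le⟩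

lemma pairwiseDisjoint_Delta : (Set.Ioo (0 : ℚ) 1).PairwiseDisjoint Delta := by
  intro r hr s hs hrs
  refine Set.disjoint_left.2 fun a ha ha' => hrs ?_
  rw [Delta_eq hr] at ha
  rw [Delta_eq hs] at ha'
  exact_mod_cast slope_unique (cast_mem_Ioo hr) (cast_mem_Ioo hs) ha ha'

lemma injOn_Delta : Set.InjOn Delta (Set.Ioo (0 : ℚ) 1) := by
  intro r hr s hs h
  by_contra hne
  exact Set.disjoint_left.1 (pairwiseDisjoint_Delta hr hs hne) (lowerWord_mem_Delta hr)
    (h ▸ lowerWord_mem_Delta hr)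

lemma isConstancyInterval_Delta {r : ℚ} (hr : r ∈ Set.Ioo (0 : ℚ) 1) :
    IsConstancyInterval phi (Set.Ioo (1 / 4 : ℝ) (1 / 2)) (Delta r) := by
  refine ⟨Delta_subset hr, Set.ordConnected_Icc, ?_, _, fun a ha => phi_eq_of_mem_Delta hr ha⟩
  rw [Delta_eq hr]
  have h := dyadic_lowerWord_lt_of_rational ⟨hr.1.le, hr.2⟩
  exact ⟨_, Set.left_mem_Icc.2 h.le, _, Set.right_mem_Icc.2 h.le, h.ne⟩

/-- Different slopes give different values of `φ`, so a set on which `φ` is constant belongs to a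
single slope; for an irrational slope there is only one point. -/
lemma exists_subset_Delta {I : Set ℝ}
    (hI : IsConstancyInterval phi (Set.Ioo (1 / 4 : ℝ) (1 / 2)) I) :
    ∃ r ∈ Set.Ioo (0 : ℚ) 1, I ⊆ Delta r := by
  obtain ⟨hU, -, hnt, c, hc⟩ := hI
  obtain ⟨x, hx⟩ := hnt.nonempty
  obtain ⟨γ, hγ, hxγ⟩ := exists_slope (hU hx)
  have hsub : I ⊆ Set.Icc (dyadic (lowerWord γ)) (dyadic (limitWord γ)) := by
    intro y hy
    obtain ⟨γ', hγ', hyγ'⟩ := exists_slope (hU hy)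
    have h : dyadic (upperWord γ) = dyadic (upperWord γ') := by
      rw [← phi_eq hγ hxγ, ← phi_eq hγ' hyγ', hc x hx, hc y hy]
    rwa [dyadic_upperWord_strictMonoOn.injOn hγ hγ' h]
  by_cases hirr : Irrational γ
  · rw [dyadic_lowerWord_eq_of_irrational ⟨hγ.1.le, hγ.2⟩ hirr, Set.Icc_self] at hsub
    exact absurd hnt (Set.not_nontrivial_iff.2 (Set.subsingleton_singleton.anti hsub))
  · obtain ⟨r, rfl⟩ := not_not.1 hirr
    have hr : r ∈ Set.Ioo (0 : ℚ) 1 := ⟨by exact_mod_cast hγ.1, by exact_mod_cast hγ.2⟩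
    exact ⟨r, hr, by rwa [Delta_eq hr]⟩

lemma plateaus_phi_eq :
    plateaus phi (Set.Ioo (1 / 4 : ℝ) (1 / 2)) = Delta '' Set.Ioo (0 : ℚ) 1 := by
  ext I
  constructor
  · intro hI
    obtain ⟨r, hr, hsub⟩ := exists_subset_Delta hI.prop
    exact ⟨r, hr, (hI.le_of_ge (isConstancyInterval_Delta hr) hsub).antisymm hsub⟩
  · rintro ⟨r, hr, rfl⟩
    refine ⟨isConstancyInterval_Delta hr, fun I hI hsub => ?_⟩
    obtain ⟨s, hs, hIs⟩ := exists_subset_Delta hI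
    have hrs : r = s := by
      by_contra hne
      exact Set.disjoint_left.1 (pairwiseDisjoint_Delta hr hs hne) (lowerWord_mem_Delta hr)
        (hIs (hsub (lowerWord_mem_Delta hr)))
    rw [hrs]
    exact hIs

lemma mem_D0_iff (p : ℝ × ℝ) : p ∈ D0 ↔ p ∈ box ∧ p.2 ≤ phi p.1 := by
  refine and_congr_right fun hp => ?_
  obtain ⟨γ, hγ, ha⟩ := exists_slope hp.1
  have hb : p.2 < 3 / 4 := hp.2.2
  rw [phi_eq hγ ha, J_ne_iff hγ ha (by linarith)]

/-! ### The dimension of the exceptional set -/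

lemma exceptionalSet_subset :
    exceptionalSet ⊆ (fun γ => dyadic (lowerWord γ)) '' Set.Ioo (0 : ℝ) 1 := by
  rintro a ⟨ha, hnot⟩
  obtain ⟨γ, hγ, h⟩ := exists_slope ha
  refine ⟨γ, hγ, ?_⟩
  by_cases hirr : Irrational γ
  · have heq := dyadic_lowerWord_eq_of_irrational ⟨hγ.1.le, hγ.2⟩ hirr
    rw [← heq] at h
    exact le_antisymm h.1 h.2
  · obtain ⟨r, rfl⟩ := not_not.1 hirr
    have hr : r ∈ Set.Ioo (0 : ℚ) 1 := ⟨by exact_mod_cast hγ.1, by exact_mod_cast hγ.2⟩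
    exact absurd (Set.mem_iUnion₂.2 ⟨r, hr, by rwa [Delta_eq hr]⟩) hnot

/-- A numerical label of the first `n` letters of the lower word of slope `γ`: the sum of the
counts of ones in its first `n` nonempty prefixes. -/
noncomputable def prefixLabel (n : ℕ) (γ : ℝ) : ℤ :=
  ∑ j ∈ Finset.range n, ones (lowerWord γ) (j + 1)

lemma prefixLabel_nonneg (n : ℕ) (γ : ℝ) : 0 ≤ prefixLabel n γ :=
  Finset.sum_nonneg fun _ _ => ones_nonneg _ _

lemma prefixLabel_le (n : ℕ) (γ : ℝ) : prefixLabel n γ ≤ n ^ 2 := by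
  refine (Finset.sum_le_card_nsmul _ _ (n : ℤ) fun j hj => (ones_le _ _).trans ?_).trans ?_
  · exact_mod_cast Finset.mem_range.1 hj
  · simp [sq]

lemma ones_lowerWord_mono {γ γ' : ℝ} (hγ : γ ∈ Set.Icc (0 : ℝ) 1) (hγ' : γ' ∈ Set.Icc (0 : ℝ) 1)
    (h : γ ≤ γ') (n : ℕ) : ones (lowerWord γ) n ≤ ones (lowerWord γ') n := by
  rw [ones_lowerWord hγ, ones_lowerWord hγ']
  exact Int.ceil_mono (mul_le_mul_of_nonneg_left h (Nat.cast_nonneg _))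

/-- Since the counts of ones are monotone in the slope, the label determines the prefix. -/
lemma lowerWord_prefix_eq {γ γ' : ℝ} (hγ : γ ∈ Set.Icc (0 : ℝ) 1) (hγ' : γ' ∈ Set.Icc (0 : ℝ) 1)
    {n : ℕ} (h : prefixLabel n γ = prefixLabel n γ') :
    ∀ j < n, lowerWord γ j = lowerWord γ' j := by
  wlog hle : γ ≤ γ' generalizing γ γ'
  · exact fun j hj => (this hγ' hγ h.symm (le_of_not_ge hle) j hj).symm
  have h1 := (Finset.sum_eq_sum_iff_of_le fun j _ =>
    ones_lowerWord_mono hγ hγ' hle (j + 1)).1 h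
  have h2 : ∀ j ≤ n, ones (lowerWord γ) j = ones (lowerWord γ') j := by
    intro j hj
    rcases j with _ | j
    · simp
    · exact h1 j (Finset.mem_range.2 hj)
  exact fun j hj => letter_eq_of_ones (by rw [h2 _ hj, h2 _ hj.le])

open Filter Topology MeasureTheory in
/-- The `n ^ 2 + 1` possible labels yield a cover by that many sets of diameter at most
`2 ^ (-n)`. -/
lemma dimH_lowerWord_image :
    dimH ((fun γ => dyadic (lowerWord γ)) '' Set.Ioo (0 : ℝ) 1) = 0 := by
  refine le_antisymm (ENNReal.le_of_forall_pos_le_add fun d hd _ => ?_) zero_le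
  rw [zero_add]
  refine dimH_le_of_hausdorffMeasure_ne_top (ne_top_of_le_ne_top ENNReal.zero_ne_top ?_)
  set t : (n : ℕ) → Fin (n ^ 2 + 1) → Set ℝ := fun n i =>
    (fun γ => dyadic (lowerWord γ)) '' {γ | γ ∈ Set.Ioo (0 : ℝ) 1 ∧ prefixLabel n γ = (i : ℕ)}
    with ht
  have hdiam : ∀ n i, Metric.ediam (t n i) ≤ ENNReal.ofReal ((1 / 2) ^ n) := by
    intro n i
    refine Metric.ediam_le ?_
    rintro _ ⟨γ, hγ, rfl⟩ _ ⟨γ', hγ', rfl⟩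
    have hpre := lowerWord_prefix_eq (Set.Ioo_subset_Icc_self hγ.1)
      (Set.Ioo_subset_Icc_self hγ'.1) (hγ.2.trans hγ'.2.symm)
    have h1 := dyadic_le_add_of_prefix_eq hpre
    have h2 := dyadic_le_add_of_prefix_eq fun j hj => (hpre j hj).symm
    rw [edist_dist, Real.dist_eq, div_pow, one_pow]
    refine ENNReal.ofReal_le_ofReal (abs_le.2 ⟨?_, ?_⟩) <;> linarith
  have hcover : ∀ n, (fun γ => dyadic (lowerWord γ)) '' Set.Ioo (0 : ℝ) 1 ⊆ ⋃ i, t n i := by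
    rintro n _ ⟨γ, hγ, rfl⟩
    have h0 := prefixLabel_nonneg n γ
    have h1 := prefixLabel_le n γ
    have h2 : (prefixLabel n γ).toNat < n ^ 2 + 1 := by
      zify
      omega
    exact Set.mem_iUnion.2 ⟨⟨_, h2⟩, γ, ⟨hγ, (Int.toNat_of_nonneg h0).symm⟩, rfl⟩
  have hr : Tendsto (fun n : ℕ => ENNReal.ofReal ((1 / 2 : ℝ) ^ n)) atTop (𝓝 0) := by
    rw [← ENNReal.ofReal_zero]
    exact ENNReal.tendsto_ofReal
      (tendsto_pow_atTop_nhds_zero_of_lt_one (by norm_num) (by norm_num))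
  refine (Measure.hausdorffMeasure_le_liminf_sum (d : ℝ) _ _ hr t
    (Eventually.of_forall hdiam) (Eventually.of_forall hcover)).trans ?_
  set x : ℝ := (1 / 2 : ℝ) ^ (d : ℝ) with hx
  have hx0 : 0 ≤ x := by positivity
  have hx1 : x < 1 := Real.rpow_lt_one (by norm_num) (by norm_num) (by exact_mod_cast hd)
  have hlim : Tendsto (fun n : ℕ => ENNReal.ofReal ((n : ℝ) ^ 2 * x ^ n + x ^ n)) atTop (𝓝 0) := by
    rw [← ENNReal.ofReal_zero]
    refine ENNReal.tendsto_ofReal ?_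
    simpa using (tendsto_pow_const_mul_const_pow_of_lt_one 2 hx0 hx1).add
      (tendsto_pow_atTop_nhds_zero_of_lt_one hx0 hx1)
  rw [← hlim.liminf_eq]
  refine liminf_le_liminf (Eventually.of_forall fun n => ?_)
  have hterm : ∀ i, Metric.ediam (t n i) ^ (d : ℝ) ≤ ENNReal.ofReal (x ^ n) := by
    intro i
    refine (ENNReal.rpow_le_rpow (hdiam n i) d.coe_nonneg).trans_eq ?_
    rw [ENNReal.ofReal_rpow_of_nonneg (by positivity) d.coe_nonneg, hx, ← Real.rpow_natCast,
      ← Real.rpow_natCast, ← Real.rpow_mul (by norm_num), ← Real.rpow_mul (by norm_num), mul_comm]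
  refine (Finset.sum_le_card_nsmul _ _ _ fun i _ => hterm i).trans_eq ?_
  rw [Finset.card_univ, Fintype.card_fin, nsmul_eq_mul, ← ENNReal.ofReal_natCast,
    ← ENNReal.ofReal_mul (Nat.cast_nonneg _)]
  congr 1
  push_cast
  ring

lemma dimH_exceptionalSet : dimH exceptionalSet = 0 :=
  le_antisymm ((dimH_mono exceptionalSet_subset).trans_eq dimH_lowerWord_image) zero_le

end HoleDoubling

theorem mainTheorem4 :
    -- the description of `D₀`
    HoleDoubling.D0 = {p : ℝ × ℝ | p ∈ HoleDoubling.box ∧ p.2 ≤ HoleDoubling.phi p.1} ∧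
    -- the words `ω_r^-` and `ω_r^+` exist
    (∀ r ∈ Set.Ioo (0 : ℚ) 1,
      IsGreatest (HoleDoubling.cycWords r 0) (HoleDoubling.omegaMinus r) ∧
      IsLeast (HoleDoubling.cycWords r 1) (HoleDoubling.omegaPlus r)) ∧
    -- the value of `φ` on `Δ(r)`
    (∀ r ∈ Set.Ioo (0 : ℚ) 1, ∀ a ∈ HoleDoubling.Delta r,
      HoleDoubling.phi a = HoleDoubling.dyadic (HoleDoubling.perpetual (HoleDoubling.omegaPlus r))) ∧
    -- the plateaus of `φ` are exactly the pairwise disjoint intervals `Δ(r)`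
    (Set.Ioo (0 : ℚ) 1).PairwiseDisjoint HoleDoubling.Delta ∧
    HoleDoubling.plateaus HoleDoubling.phi (Set.Ioo (1 / 4 : ℝ) (1 / 2)) =
      HoleDoubling.Delta '' Set.Ioo (0 : ℚ) 1 ∧
    (HoleDoubling.plateaus HoleDoubling.phi (Set.Ioo (1 / 4 : ℝ) (1 / 2))).Infinite ∧
    (HoleDoubling.plateaus HoleDoubling.phi (Set.Ioo (1 / 4 : ℝ) (1 / 2))).Countable ∧
    -- the set of points outside the plateaus is `𝒮`, and it has Hausdorff dimension zero
    Set.Ioo (1 / 4 : ℝ) (1 / 2) \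
        ⋃₀ HoleDoubling.plateaus HoleDoubling.phi (Set.Ioo (1 / 4 : ℝ) (1 / 2)) =
      HoleDoubling.exceptionalSet ∧
    dimH HoleDoubling.exceptionalSet = 0 := by
  refine ⟨Set.ext HoleDoubling.mem_D0_iff, fun r hr =>
    ⟨HoleDoubling.omegaMinus_spec hr, HoleDoubling.omegaPlus_spec hr⟩,
    fun r hr a ha => HoleDoubling.phi_eq_of_mem_Delta hr ha, HoleDoubling.pairwiseDisjoint_Delta,
    HoleDoubling.plateaus_phi_eq, ?_, ?_, ?_, HoleDoubling.dimH_exceptionalSet⟩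
  · rw [HoleDoubling.plateaus_phi_eq]
    exact (Set.Ioo_infinite one_pos).image HoleDoubling.injOn_Delta
  · rw [HoleDoubling.plateaus_phi_eq]
    exact (Set.to_countable _).image _
  · rw [HoleDoubling.plateaus_phi_eq, Set.sUnion_image]
    rfl
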